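/- Let $G$ be a finite biconnected simple graph: any two distinct vertices are joined by two distinct paths sharing only their endpoints. A \emph{planar rectilinear drawing} of $G$ places the vertices at distinct points of the Euclidean plane and draws every edge as a horizontal or vertical segment, so that distinct edges meet only at common end-vertices. A \emph{rectilinear representation} $H$ of $G$ (with fixed orientation) is a non-empty class consisting of all planar rectilinear drawings of $G$ in which every edge has a prescribed direction, i.e. for each edge $uv$ it is prescribed whether $u$ is to the left of, to the right of, above, or below $v$; equivalently, the planar embedding and all angles at the vertices are prescribed, and the orientation of the drawing, among its rotations by multiples of $90^\circ$, is fixed. The members of the class are the \emph{rectilinear drawings of $H$}. $H$ is \emph{convex} if every internal (bounded) face is a rectangle and the external face is bounded by an orthoconvex polygon, i.e. every horizontal or vertical line meets the closed region enclosed by the outer boundary in the empty set or a single segment (this holds for one drawing of $H$ if and only if it holds for all of them). A drawing is \emph{greedy} if for every ordered pair of vertices $u,v$ there is a path $u=v_0,v_1,\dots,v_k=v$ in $G$ along which the Euclidean distance to $v$ strictly decreases at every step. $H$ is \emph{universal greedy} if every rectilinear drawing of $H$ is greedy. Let $D_x$ be the directed graph obtained from $H$ by orienting the horizontal edges from left to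 right and contracting every maximal path of vertical edges (possibly a single vertex) to a node; let $c_x(u)$ be the node containing the vertex $u$. Symmetrically, let $D_y$ be obtained by orienting the vertical edges upwards and contracting every maximal path of horizontal edges, with $c_y(u)$ the node containing $u$. Two vertices $u,v$ are \emph{comparable} in $D_x$ if $c_x(u)\ne c_x(v)$ and $D_x$ contains a directed path between $c_x(u)$ and $c_x(v)$ in one of the two directions; comparability in $D_y$ is defined in the same way. Vertices $u,v$ with $c_x(u)\neq c_x(v)$ and $c_y(u)\neq c_y(v)$ form a \emph{conflict} if they are not comparable in $D_x$ or not comparable in $D_y$. $H$ is \emph{conflict-free} if it has no conflict. **Theorem.** Let $H$ be a convex rectilinear representation of a biconnected plane graph. Then $H$ is universal greedy if and only if it is conflict-free. -/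

import Mathlib

/-- The Euclidean plane; `p 0` is the `x`-coordinate and `p 1` the `y`-coordinate of `p`. -/
abbrev Plane : Type := EuclideanSpace ℝ (Fin 2)

section Graphs

variable {V : Type*}

/-- A graph is biconnected if every two vertices are joined by (at least) two distinct paths
that share no vertex other than their endpoints. -/
def IsBiconnected (G : SimpleGraph V) : Prop :=
  ∀ u v : V, u ≠ v → ∃ p q : G.Walk u v, p.IsPath ∧ q.IsPath ∧ p ≠ q ∧
    ∀ w, w ∈ p.support → w ∈ q.support → w = u ∨ w = v

/-- A planar rectilinear drawing of `G`: the vertices are placed at distinct points, every edge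
is drawn as a horizontal or vertical straight-line segment, and two distinct edges meet only at
common end-vertices. -/
structure RectilinearDrawing (G : SimpleGraph V) where
  /-- The position of each vertex. -/
  pos : V → Plane
  injective : Function.Injective pos
  rectilinear : ∀ u v, G.Adj u v → pos u 0 = pos v 0 ∨ pos u 1 = pos v 1
  planar : ∀ u v w z, G.Adj u v → G.Adj w z → s(u, v) ≠ s(w, z) →
    ∀ p ∈ segment ℝ (pos u) (pos v) ∩ segment ℝ (pos w) (pos z),
      ∃ a, a ∈ s(u, v) ∧ a ∈ s(w, z) ∧ p = pos a

namespace RectilinearDrawing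

variable {G : SimpleGraph V} (Γ : RectilinearDrawing G)

/-- `uv` is a horizontal edge with `u` to the left of `v`. -/
def LeftOf (u v : V) : Prop :=
  G.Adj u v ∧ Γ.pos u 1 = Γ.pos v 1 ∧ Γ.pos u 0 < Γ.pos v 0

/-- `uv` is a vertical edge with `u` below `v`. -/
def Below (u v : V) : Prop :=
  G.Adj u v ∧ Γ.pos u 0 = Γ.pos v 0 ∧ Γ.pos u 1 < Γ.pos v 1

/-- The set of points of the plane occupied by the drawing. -/
def carrier : Set Plane :=
  Set.range Γ.pos ∪ ⋃ (u : V) (v : V) (_ : G.Adj u v), segment ℝ (Γ.pos u) (Γ.pos v)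

/-- The faces are the connected components of the complement of the drawing. -/
def IsFace (F : Set Plane) : Prop :=
  ∃ p ∈ Γ.carrierᶜ, F = connectedComponentIn Γ.carrierᶜ p

/-- The internal faces are the bounded ones. -/
def IsInternalFace (F : Set Plane) : Prop :=
  Γ.IsFace F ∧ Bornology.IsBounded F

/-- The external face: the points of the unbounded face. -/
def externalFace : Set Plane :=
  {p | p ∈ Γ.carrierᶜ ∧ ¬ Bornology.IsBounded (connectedComponentIn Γ.carrierᶜ p)}

/-- A path of `G` ending at `v` is distance-decreasing if the Euclidean distance to `v` strictly
decreases at every step. -/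
def DistanceDecreasing {u v : V} (p : G.Walk u v) : Prop :=
  ∀ i, i < p.length →
    dist (Γ.pos (p.getVert (i + 1))) (Γ.pos v) < dist (Γ.pos (p.getVert i)) (Γ.pos v)

/-- The drawing is greedy if every ordered pair of vertices is joined by a distance-decreasing
path. -/
def IsGreedy : Prop :=
  ∀ u v : V, ∃ p : G.Walk u v, p.IsPath ∧ Γ.DistanceDecreasing p

end RectilinearDrawing

/-- The interior of a (nondegenerate) axis-parallel rectangle. -/
def IsOpenRectangle (F : Set Plane) : Prop :=
  ∃ a b c d : ℝ, a < b ∧ c < d ∧ F = {p | p 0 ∈ Set.Ioo a b ∧ p 1 ∈ Set.Ioo c d}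

/-- A region is orthoconvex if every vertical or horizontal line meets it in the empty set or in
a single segment. -/
def IsOrthoconvex (P : Set Plane) : Prop :=
  ∀ (i : Fin 2) (c : ℝ), P ∩ {p | p i = c} = ∅ ∨
    ∃ a b : Plane, P ∩ {p | p i = c} = segment ℝ a b

/-- Every internal face is a rectangle, and the region enclosed by the boundary of the external
face (boundary included), that is, the complement of the external face, is orthoconvex. -/
def RectilinearDrawing.IsConvex {G : SimpleGraph V} (Γ : RectilinearDrawing G) : Prop :=
  (∀ F, Γ.IsInternalFace F → IsOpenRectangle F) ∧ IsOrthoconvex Γ.externalFaceᶜ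

/-- A rectilinear representation of `G`, with its orientation fixed: an equivalence class of
planar rectilinear drawings of `G`, given by the data which the drawings in the class share,
namely for every edge whether it is horizontal or vertical and which end-vertex is the left
(respectively, the lower) one.  These directions determine the cyclic order of the edges around
every vertex and all angles between consecutive edges.  For a connected graph they hence determine
the boundaries of all faces, and which of them is external, as the angles turn by `360` degrees
along an internal face and by `-360` degrees along the external one.  Conversely, for a connected
graph the cyclic orders and the angles determine the directions up to a rotation of the whole
drawing by a multiple of `90` degrees. -/
structure RectilinearRepresentation (G : SimpleGraph V) where
  /-- `uv` is a horizontal edge with `u` to the left of `v`. -/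
  LeftOf : V → V → Prop
  /-- `uv` is a vertical edge with `u` below `v`. -/
  Below : V → V → Prop
  /-- The class contains at least one drawing. -/
  realizable : ∃ Γ : RectilinearDrawing G,
    (∀ u v, Γ.LeftOf u v ↔ LeftOf u v) ∧ (∀ u v, Γ.Below u v ↔ Below u v)

namespace RectilinearRepresentation

variable {G : SimpleGraph V} (H : RectilinearRepresentation G)

/-- `Γ` is a rectilinear drawing of the representation `H`. -/
def IsDrawing (Γ : RectilinearDrawing G) : Prop :=
  (∀ u v, Γ.LeftOf u v ↔ H.LeftOf u v) ∧ (∀ u v, Γ.Below u v ↔ H.Below u v)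

/-- `H` is convex if its internal faces are rectangular and its external face is bounded by an
orthoconvex polygon.  This depends only on the angles, so it holds in one drawing of `H` if and
only if it holds in all of them. -/
def IsConvex : Prop :=
  ∃ Γ : RectilinearDrawing G, H.IsDrawing Γ ∧ Γ.IsConvex

/-- `H` is universal greedy if every rectilinear drawing of it is greedy. -/
def IsUniversalGreedy : Prop :=
  ∀ Γ : RectilinearDrawing G, H.IsDrawing Γ → Γ.IsGreedy

/-- The graph of all vertical edges; its connected components are the maximal vertical paths. -/
def verticalGraph : SimpleGraph V := SimpleGraph.fromRel H.Below

/-- The graph of all horizontal edges; its connected components are the maximal horizontal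
paths. -/
def horizontalGraph : SimpleGraph V := SimpleGraph.fromRel H.LeftOf

/-- The maximal vertical path containing `u`. -/
def cx (u : V) : H.verticalGraph.ConnectedComponent := H.verticalGraph.connectedComponentMk u

/-- The maximal horizontal path containing `u`. -/
def cy (u : V) : H.horizontalGraph.ConnectedComponent := H.horizontalGraph.connectedComponentMk u

/-- `D_x`: the horizontal edges are oriented from left to right, and every maximal vertical path
is contracted into a node. -/
def Dx : Digraph H.verticalGraph.ConnectedComponent where
  Adj c d := ∃ u v, H.LeftOf u v ∧ H.cx u = c ∧ H.cx v = d

/-- `D_y`: the vertical edges are oriented upwards, and every maximal horizontal path is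
contracted into a node. -/
def Dy : Digraph H.horizontalGraph.ConnectedComponent where
  Adj c d := ∃ u v, H.Below u v ∧ H.cy u = c ∧ H.cy v = d

/-- `u ≺ₓ v`: there is a directed path in `D_x` from the node of `u` to that of `v`. -/
def PrecX (u v : V) : Prop :=
  H.cx u ≠ H.cx v ∧ Relation.TransGen H.Dx.Adj (H.cx u) (H.cx v)

/-- `u ≺_y v`: there is a directed path in `D_y` from the node of `u` to that of `v`. -/
def PrecY (u v : V) : Prop :=
  H.cy u ≠ H.cy v ∧ Relation.TransGen H.Dy.Adj (H.cy u) (H.cy v)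

/-- `u` and `v` are comparable in `D_x`. -/
def ComparableX (u v : V) : Prop := H.PrecX u v ∨ H.PrecX v u

/-- `u` and `v` are comparable in `D_y`. -/
def ComparableY (u v : V) : Prop := H.PrecY u v ∨ H.PrecY v u

/-- `u` and `v` form a conflict: they lie neither on a common vertical nor on a common horizontal
path, and they are incomparable in `D_x` or in `D_y`. -/
def IsConflict (u v : V) : Prop :=
  H.cx u ≠ H.cx v ∧ H.cy u ≠ H.cy v ∧ (¬ H.ComparableX u v ∨ ¬ H.ComparableY u v)

/-- `H` has no conflict. -/
def IsConflictFree : Prop := ∀ u v : V, ¬ H.IsConflict u v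

end RectilinearRepresentation

end Graphs

open Set

/-! The orders of $D_x$ and $D_y$ depend only on directions, and every drawing's coordinates
increase along them (`Prec.lt`). One convex drawing is used to turn geometry into order. Two
vertical paths met by a horizontal line are ordered in $D_x$: between consecutive ones the line
follows an edge or crosses a rectangular face, whose lower side links its left and right sides, and
orthoconvexity keeps the line inside the region (`prec_of_horizontal`). A staircase walk towards a
vertex above and to the right cannot get stuck (`quadrant_empty`). Hence any two distinct vertices
are comparable in $D_x$ or in $D_y$ (`comparable_of_ne`). It follows that all coordinates respecting
the directions give planar drawings (`planar_of_respects`), so $x$ and $y$ can be changed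
independently.

Necessity: if $u,v$ lie on different vertical paths and are incomparable in $D_x$, they can be put
on one vertical line. Stretching the $y$-coordinate at the right place makes a vertex $s$ on the
path of $u$ a dead end for greedy routing to $v$: its upper neighbour overshoots $v$ by more than
the distance from $s$ to $v$ (`exists_stuck`).

Sufficiency: let $u$ precede $v$ in both orders. Without conflicts, an edge leaving $u$ rightwards
or upwards without progress must pass $v$. If one such edge exists then so does the other
(`exists_up_of_overshoot`), but both together would span a rectangle with $v$ inside, which the
faces forbid (`not_overshoot_both`). So some edge makes progress in the orders, and therefore in
every drawing (`exists_closer`). -/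

/-- `Rightward G x y u v`: the vertex `v` is the other end of an edge leaving `u` horizontally in the
positive direction, when `x` and `y` are the coordinate functions. -/
def Rightward {V : Type*} (G : SimpleGraph V) (x y : V → ℝ) (u v : V) : Prop :=
  G.Adj u v ∧ y u = y v ∧ x u < x v

/-- The class of `u` after contraction of the relation `B`. -/
abbrev strip {V : Type*} (B : V → V → Prop) (u : V) : (SimpleGraph.fromRel B).ConnectedComponent :=
  (SimpleGraph.fromRel B).connectedComponentMk u

/-- There is a nonempty directed path of `L`-edges from `u` to `v` after contraction of the
`B`-edges. -/
def Prec {V : Type*} (L B : V → V → Prop) (u v : V) : Prop :=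
  Relation.TransGen (fun c d => ∃ p q, L p q ∧ strip B p = c ∧ strip B q = d) (strip B u) (strip B v)

/-! ### The order obtained by contracting one kind of edge. -/

section Prec

variable {V : Type*} {L B : V → V → Prop}

lemma Prec.trans {u v w : V} (h : Prec L B u v) (h' : Prec L B v w) : Prec L B u w :=
  Relation.TransGen.trans h h'

lemma Prec.of_rel {u v : V} (h : L u v) : Prec L B u v :=
  Relation.TransGen.single ⟨u, v, h, rfl, rfl⟩

lemma Prec.congr {u v u' v' : V} (h : Prec L B u v) (hu : strip B u = strip B u')
    (hv : strip B v = strip B v') : Prec L B u' v' := by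
  unfold Prec at *
  rwa [hu, hv] at h

lemma prec_flip_left {u v : V} : Prec (flip L) B u v ↔ Prec L B v u := by
  unfold Prec
  rw [← Relation.transGen_swap]
  have : (Function.swap fun c d => ∃ p q, flip L p q ∧ strip B p = c ∧ strip B q = d) =
      fun c d => ∃ p q, L p q ∧ strip B p = c ∧ strip B q = d := by
    funext c d
    apply propext
    constructor
    · rintro ⟨p, q, h, h1, h2⟩
      exact ⟨q, p, h, h2, h1⟩
    · rintro ⟨p, q, h, h1, h2⟩
      exact ⟨q, p, h, h2, h1⟩
  rw [this]

lemma fromRel_flip : SimpleGraph.fromRel (flip B) = SimpleGraph.fromRel B := by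
  ext a b
  simp [SimpleGraph.fromRel_adj, flip, or_comm]

lemma prec_flip_right {u v : V} : Prec L (flip B) u v ↔ Prec L B u v := by
  unfold Prec strip
  rw [fromRel_flip]

lemma strip_flip {u v : V} : strip (flip B) u = strip (flip B) v ↔ strip B u = strip B v := by
  unfold strip
  rw [fromRel_flip]

lemma strip_induction {u : V} {S : V → Prop} (hu : S u)
    (h : ∀ a b, S a → (B a b ∨ B b a) → S b) {v : V} (hv : strip B u = strip B v) : S v := by
  obtain ⟨p⟩ := SimpleGraph.ConnectedComponent.exact hv
  clear hv
  induction p with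
  | nil => exact hu
  | cons hadj _ ih => exact ih (h _ _ hu ((SimpleGraph.fromRel_adj _ _ _).1 hadj).2)

lemma strip_eq_of_rel {u v : V} (h : B u v) : strip B u = strip B v := by
  by_cases huv : u = v
  · rw [huv]
  · exact SimpleGraph.ConnectedComponent.sound
      (SimpleGraph.Adj.reachable ((SimpleGraph.fromRel_adj _ _ _).2 ⟨huv, Or.inl h⟩))

lemma eq_of_strip_eq {f : V → ℝ} (hB : ∀ p q, B p q → f p = f q) {u v : V}
    (h : strip B u = strip B v) : f u = f v :=
  strip_induction (S := fun w => f u = f w) rfl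
    (fun a b ha hab => ha.trans (hab.elim (hB a b) fun h => (hB b a h).symm)) h

/-- The bridge from the combinatorial order to coordinates, applied to any coordinate that respects
the directions. Such a function is constant on contracted classes, so it increases along directed
paths. -/
lemma Prec.lt {f : V → ℝ} (hL : ∀ p q, L p q → f p < f q) (hB : ∀ p q, B p q → f p = f q)
    {u v : V} (h : Prec L B u v) : f u < f v := by
  have key : ∀ c, Relation.TransGen
      (fun c d => ∃ p q, L p q ∧ strip B p = c ∧ strip B q = d) (strip B u) c →
      ∀ w, strip B w = c → f u < f w := by
    intro c hc
    induction hc with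
    | single h =>
      obtain ⟨p, q, h, h1, h2⟩ := h
      intro w hw
      rw [← eq_of_strip_eq hB h1, ← eq_of_strip_eq hB (h2.trans hw.symm)]
      exact hL p q h
    | tail _ h ih =>
      obtain ⟨p, q, h, h1, h2⟩ := h
      intro w hw
      rw [← eq_of_strip_eq hB (h2.trans hw.symm)]
      exact (ih p h1).trans (hL p q h)
  exact key _ h v rfl

end Prec

section Rightward

variable {V : Type*} {G : SimpleGraph V} {x y : V → ℝ}

lemma rightward_neg_left : Rightward G (fun u => -x u) y = flip (Rightward G x y) := by
  funext u v
  simp only [Rightward, flip, neg_lt_neg_iff, G.adj_comm u v, eq_comm (a := y u)]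

lemma rightward_neg_right : Rightward G x (fun u => -y u) = Rightward G x y := by
  funext u v
  simp only [Rightward, neg_inj]

end Rightward

/-! ### Convex drawings in coordinates, and their symmetries. -/

/-- The point with coordinates `s` and `t` lies on an edge. -/
def OnEdges {V : Type*} (G : SimpleGraph V) (x y : V → ℝ) (s t : ℝ) : Prop :=
  ∃ u v, G.Adj u v ∧ s ∈ uIcc (x u) (x v) ∧ t ∈ uIcc (y u) (y v)

/-- The combinatorial and metric content of a convex rectilinear drawing in coordinates: `P` is the
region enclosed by the outer boundary. -/
structure ConvexGrid {V : Type*} (G : SimpleGraph V) (x y : V → ℝ) (P : ℝ → ℝ → Prop) : Prop where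
  preconnected : G.Preconnected
  exists_adj : ∀ u, ∃ v, G.Adj u v
  inj : ∀ u v, x u = x v → y u = y v → u = v
  rect : ∀ u v, G.Adj u v → x u = x v ∨ y u = y v
  planar : ∀ u v w z, G.Adj u v → G.Adj w z → s(u, v) ≠ s(w, z) → ∀ s t,
    s ∈ uIcc (x u) (x v) → t ∈ uIcc (y u) (y v) → s ∈ uIcc (x w) (x z) → t ∈ uIcc (y w) (y z) →
    ∃ a, a ∈ s(u, v) ∧ a ∈ s(w, z) ∧ x a = s ∧ y a = t
  region : ∀ s t, OnEdges G x y s t → P s t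
  hconvex : ∀ s s' r t, P s t → P s' t → s ≤ r → r ≤ s' → P r t
  vconvex : ∀ s t t' r, P s t → P s t' → t ≤ r → r ≤ t' → P s r
  face : ∀ s t, P s t → ¬ OnEdges G x y s t → ∃ a b c d, s ∈ Ioo a b ∧ t ∈ Ioo c d ∧
    (∀ p ∈ Ioo a b, ∀ q ∈ Ioo c d, ¬ OnEdges G x y p q) ∧
    (∀ q ∈ Icc c d, OnEdges G x y a q ∧ OnEdges G x y b q) ∧
    (∀ p ∈ Icc a b, OnEdges G x y p c ∧ OnEdges G x y p d)

lemma mem_uIcc_neg {a b s : ℝ} : s ∈ uIcc (-a) (-b) ↔ -s ∈ uIcc a b := by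
  rw [← Set.neg_mem_neg (a := s), Set.neg_uIcc, neg_neg, neg_neg]

namespace ConvexGrid

variable {V : Type*} {G : SimpleGraph V} {x y : V → ℝ} {P : ℝ → ℝ → Prop}

lemma onEdges_swap {s t : ℝ} : OnEdges G y x s t ↔ OnEdges G x y t s := by
  simp only [OnEdges, and_comm]

lemma onEdges_neg {s t : ℝ} : OnEdges G (fun u => -x u) y s t ↔ OnEdges G x y (-s) t := by
  simp only [OnEdges, mem_uIcc_neg]

/-- Together with `neg` this generates the symmetries of the square, so each geometric fact is
proved for one direction only; `swap.neg.swap` reflects the $y$-axis. -/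
lemma swap (h : ConvexGrid G x y P) : ConvexGrid G y x fun s t => P t s where
  preconnected := h.preconnected
  exists_adj := h.exists_adj
  inj u v h1 h2 := h.inj u v h2 h1
  rect u v huv := (h.rect u v huv).symm
  planar u v w z h1 h2 hne s t a1 a2 a3 a4 := by
    obtain ⟨a, b1, b2, b3, b4⟩ := h.planar u v w z h1 h2 hne t s a2 a1 a4 a3
    exact ⟨a, b1, b2, b4, b3⟩
  region s t hC := h.region t s (onEdges_swap.1 hC)
  hconvex s s' r t := h.vconvex t s s' r
  vconvex s t t' r := h.hconvex t t' r s
  face s t hP hC := by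
    obtain ⟨a, b, c, d, h1, h2, h3, h4, h5⟩ := h.face t s hP (fun hh => hC (onEdges_swap.1 hh))
    exact ⟨c, d, a, b, h2, h1, fun p hp q hq hh => h3 q hq p hp (onEdges_swap.1 hh),
      fun q hq => ⟨onEdges_swap.2 (h5 q hq).1, onEdges_swap.2 (h5 q hq).2⟩,
      fun q hq => ⟨onEdges_swap.2 (h4 q hq).1, onEdges_swap.2 (h4 q hq).2⟩⟩

lemma neg (h : ConvexGrid G x y P) : ConvexGrid G (fun u => -x u) y fun s t => P (-s) t where
  preconnected := h.preconnected
  exists_adj := h.exists_adj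
  inj u v h1 h2 := h.inj u v (neg_inj.1 h1) h2
  rect u v huv := (h.rect u v huv).imp_left neg_inj.2
  planar u v w z h1 h2 hne s t a1 a2 a3 a4 := by
    obtain ⟨a, b1, b2, b3, b4⟩ := h.planar u v w z h1 h2 hne (-s) t (mem_uIcc_neg.1 a1) a2
      (mem_uIcc_neg.1 a3) a4
    exact ⟨a, b1, b2, by rw [b3, neg_neg], b4⟩
  region s t hC := h.region (-s) t (onEdges_neg.1 hC)
  hconvex s s' r t h1 h2 h3 h4 :=
    h.hconvex (-s') (-s) (-r) t h2 h1 (neg_le_neg h4) (neg_le_neg h3)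
  vconvex s t t' r := h.vconvex (-s) t t' r
  face s t hP hC := by
    obtain ⟨a, b, c, d, h1, h2, h3, h4, h5⟩ := h.face (-s) t hP (fun hh => hC (onEdges_neg.2 hh))
    refine ⟨-b, -a, c, d, ⟨by linarith [h1.2], by linarith [h1.1]⟩, h2, fun p hp q hq hh =>
      h3 (-p) ⟨by linarith [hp.2], by linarith [hp.1]⟩ q hq (onEdges_neg.1 hh),
      fun q hq => ?_, fun p hp => ?_⟩
    · rw [onEdges_neg, onEdges_neg, neg_neg, neg_neg]
      exact (h4 q hq).symm
    · rw [onEdges_neg, onEdges_neg]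
      exact h5 (-p) ⟨by linarith [hp.2], by linarith [hp.1]⟩

/-- Planarity speaks of pairs of edges only. It applies to a vertex through any edge incident to it.
-/
lemma vertex_on_edge (h : ConvexGrid G x y P) {u v w : V} (huv : G.Adj u v)
    (hx : x w ∈ uIcc (x u) (x v)) (hy : y w ∈ uIcc (y u) (y v)) : w = u ∨ w = v := by
  by_contra! hne
  obtain ⟨z, hz⟩ := h.exists_adj w
  have hs : s(u, v) ≠ s(w, z) := by
    intro hs
    have : w ∈ s(u, v) := hs ▸ Sym2.mem_mk_left w z
    rcases Sym2.mem_iff.1 this with h1 | h1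
    · exact hne.1 h1
    · exact hne.2 h1
  obtain ⟨a, h1, -, h3, h4⟩ := h.planar u v w z huv hz hs _ _ hx hy left_mem_uIcc left_mem_uIcc
  have haw := h.inj a w h3 h4
  subst haw
  rcases Sym2.mem_iff.1 h1 with h1 | h1
  · exact hne.1 h1
  · exact hne.2 h1

lemma vertex_on_rightward (h : ConvexGrid G x y P) {u v w : V} (huv : Rightward G x y u v)
    (hx : x u ≤ x w) (hx' : x w ≤ x v) (hy : y w = y u) : w = u ∨ w = v :=
  h.vertex_on_edge huv.1 (mem_uIcc.2 (Or.inl ⟨hx, hx'⟩)) (hy ▸ left_mem_uIcc)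

lemma rightward_unique (h : ConvexGrid G x y P) {u v w : V} (huv : Rightward G x y u v)
    (huw : Rightward G x y u w) : v = w := by
  rcases le_total (x v) (x w) with hle | hle
  · rcases h.vertex_on_rightward huw huv.2.2.le hle huv.2.1.symm with h1 | h1
    · exact absurd huv.2.2 (by rw [h1]; exact lt_irrefl _)
    · exact h1
  · rcases h.vertex_on_rightward huv huw.2.2.le hle huw.2.1.symm with h1 | h1
    · exact absurd huw.2.2 (by rw [h1]; exact lt_irrefl _)
    · exact h1.symm

lemma rightward_unique' (h : ConvexGrid G x y P) {u v w : V} (huv : Rightward G x y u v)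
    (hwv : Rightward G x y w v) : u = w := by
  have := h.neg.rightward_unique (u := v) (v := u) (w := w)
  rw [rightward_neg_left] at this
  exact this huv hwv

lemma crossing (h : ConvexGrid G x y P) {u v w z : V} (huv : Rightward G x y u v)
    (hwz : Rightward G y x w z) (h1 : x u ≤ x w) (h2 : x w ≤ x v) (h3 : y w ≤ y u)
    (h4 : y u ≤ y z) : ∃ a, (a = u ∨ a = v) ∧ (a = w ∨ a = z) ∧ x a = x w ∧ y a = y u := by
  have hne : s(u, v) ≠ s(w, z) := by
    intro hs
    rcases Sym2.eq_iff.1 hs with ⟨rfl, rfl⟩ | ⟨rfl, rfl⟩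
    · exact absurd huv.2.2 (by rw [hwz.2.1]; exact lt_irrefl _)
    · exact absurd huv.2.2 (by rw [hwz.2.1]; exact lt_irrefl _)
  obtain ⟨a, a1, a2, a3, a4⟩ := h.planar u v w z huv.1 hwz.1 hne (x w) (y u)
    (mem_uIcc.2 (Or.inl ⟨h1, h2⟩)) left_mem_uIcc left_mem_uIcc (mem_uIcc.2 (Or.inl ⟨h3, h4⟩))
  exact ⟨a, Sym2.mem_iff.1 a1, Sym2.mem_iff.1 a2, a3, a4⟩

lemma adj_cases (h : ConvexGrid G x y P) {u v : V} (huv : G.Adj u v) :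
    Rightward G x y u v ∨ Rightward G x y v u ∨ Rightward G y x u v ∨ Rightward G y x v u := by
  rcases h.rect u v huv with h1 | h1
  · rcases lt_trichotomy (y u) (y v) with h2 | h2 | h2
    · exact Or.inr (Or.inr (Or.inl ⟨huv, h1, h2⟩))
    · exact absurd (h.inj u v h1 h2) huv.ne
    · exact Or.inr (Or.inr (Or.inr ⟨huv.symm, h1.symm, h2⟩))
  · rcases lt_trichotomy (x u) (x v) with h2 | h2 | h2
    · exact Or.inl ⟨huv, h1, h2⟩
    · exact absurd (h.inj u v h2 h1) huv.ne
    · exact Or.inr (Or.inl ⟨huv.symm, h1.symm, h2⟩)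

/-- Two distinct points on one horizontal line, on a common edge. -/
lemma exists_rightward_of_mem (h : ConvexGrid G x y P) {u v : V} (huv : G.Adj u v) {s s' t : ℝ}
    (hss : s < s') (hs : s ∈ uIcc (x u) (x v)) (hs' : s' ∈ uIcc (x u) (x v))
    (ht : t ∈ uIcc (y u) (y v)) :
    ∃ a b, Rightward G x y a b ∧ y a = t ∧ x a ≤ s ∧ s' ≤ x b := by
  rw [mem_uIcc] at hs hs' ht
  rcases h.adj_cases huv with h1 | h1 | h1 | h1
  · have := h1.2.1
    have := h1.2.2
    refine ⟨u, v, h1, ?_, ?_, ?_⟩ <;> rcases hs with hs | hs <;> rcases hs' with hs' | hs' <;>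
      rcases ht with ht | ht <;> linarith
  · have := h1.2.1
    have := h1.2.2
    refine ⟨v, u, h1, ?_, ?_, ?_⟩ <;> rcases hs with hs | hs <;> rcases hs' with hs' | hs' <;>
      rcases ht with ht | ht <;> linarith
  · have := h1.2.1
    exfalso
    rcases hs with hs | hs <;> rcases hs' with hs' | hs' <;> linarith
  · have := h1.2.1
    exfalso
    rcases hs with hs | hs <;> rcases hs' with hs' | hs' <;> linarith

lemma onEdges_cases (h : ConvexGrid G x y P) {s t : ℝ} (hC : OnEdges G x y s t) :
    (∃ u v, Rightward G x y u v ∧ y u = t ∧ x u ≤ s ∧ s ≤ x v) ∨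
      ∃ u v, Rightward G y x u v ∧ x u = s ∧ y u ≤ t ∧ t ≤ y v := by
  obtain ⟨u, v, huv, hs, ht⟩ := hC
  rw [mem_uIcc] at hs ht
  rcases h.adj_cases huv with h1 | h1 | h1 | h1
  · have := h1.2.1
    have := h1.2.2
    refine Or.inl ⟨u, v, h1, ?_, ?_, ?_⟩ <;> rcases hs with hs | hs <;>
      rcases ht with ht | ht <;> linarith
  · have := h1.2.1
    have := h1.2.2
    refine Or.inl ⟨v, u, h1, ?_, ?_, ?_⟩ <;> rcases hs with hs | hs <;>
      rcases ht with ht | ht <;> linarith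
  · have := h1.2.1
    have := h1.2.2
    refine Or.inr ⟨u, v, h1, ?_, ?_, ?_⟩ <;> rcases hs with hs | hs <;>
      rcases ht with ht | ht <;> linarith
  · have := h1.2.1
    have := h1.2.2
    refine Or.inr ⟨v, u, h1, ?_, ?_, ?_⟩ <;> rcases hs with hs | hs <;>
      rcases ht with ht | ht <;> linarith

lemma onEdges_vertex (h : ConvexGrid G x y P) (u : V) : OnEdges G x y (x u) (y u) := by
  obtain ⟨v, hv⟩ := h.exists_adj u
  exact ⟨u, v, hv, left_mem_uIcc, left_mem_uIcc⟩

/-- Near a point, only the edges through that point are seen. -/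
lemma exists_local [Finite V] (G : SimpleGraph V) (x y : V → ℝ) (s t : ℝ) :
    ∃ ε > 0, ∀ s' t', |s' - s| < ε → |t' - t| < ε →
    OnEdges G x y s' t' → ∃ u v, G.Adj u v ∧ s ∈ uIcc (x u) (x v) ∧ t ∈ uIcc (y u) (y v) ∧
      s' ∈ uIcc (x u) (x v) ∧ t' ∈ uIcc (y u) (y v) := by
  have key : ∀ᶠ q : ℝ × ℝ in nhds (s, t), ∀ e : V × V,
      (s, t) ∉ uIcc (x e.1) (x e.2) ×ˢ uIcc (y e.1) (y e.2) →
      q ∉ uIcc (x e.1) (x e.2) ×ˢ uIcc (y e.1) (y e.2) := by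
    rw [Filter.eventually_all]
    intro e
    by_cases he : (s, t) ∈ uIcc (x e.1) (x e.2) ×ˢ uIcc (y e.1) (y e.2)
    · exact Filter.Eventually.of_forall fun q hq => absurd he hq
    · have hcl : IsClosed (uIcc (x e.1) (x e.2) ×ˢ uIcc (y e.1) (y e.2)) :=
        isClosed_Icc.prod isClosed_Icc
      filter_upwards [hcl.isOpen_compl.mem_nhds he] with q hq _ using hq
  obtain ⟨ε, hε, hball⟩ := Metric.eventually_nhds_iff.1 key
  refine ⟨ε, hε, fun s' t' hs ht ⟨u, v, huv, h1, h2⟩ => ?_⟩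
  by_contra! hcon
  have hd : dist (s', t') (s, t) < ε := by
    rw [Prod.dist_eq]
    exact max_lt hs ht
  refine hball hd (u, v) (fun hm => ?_) ⟨h1, h2⟩
  exact hcon u v huv hm.1 hm.2 h1 h2

end ConvexGrid

/-! ### Vertical paths, faces, and comparability of vertices. -/

namespace ConvexGrid

variable {V : Type*} {G : SimpleGraph V} {x y : V → ℝ} {P : ℝ → ℝ → Prop}

/-- Horizontal edges contribute only heights of vertices. These are finitely many, so the rest of
the segment is dense in it, and the union of the vertical edges on the line is closed. -/
lemma onEdges_column (h : ConvexGrid G x y P) [Finite V] {a c d : ℝ} (hcd : c < d)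
    (hC : ∀ t ∈ Icc c d, OnEdges G x y a t) {t : ℝ} (ht : t ∈ Icc c d) :
    ∃ u v, Rightward G y x u v ∧ x u = a ∧ y u ≤ t ∧ t ≤ y v := by
  set T : Set ℝ := ⋃ e ∈ {e : V × V | Rightward G y x e.1 e.2 ∧ x e.1 = a}, Icc (y e.1) (y e.2)
    with hT
  have hTc : IsClosed T := (Set.toFinite _).isClosed_biUnion fun e _ => isClosed_Icc
  have hdense : Dense (range y)ᶜ := (Set.finite_range y).countable.dense_compl ℝ
  have hsub : Icc c d ⊆ T := by
    rw [← closure_Ioo hcd.ne]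
    refine closure_minimal ?_ hTc
    refine (hdense.open_subset_closure_inter isOpen_Ioo).trans (closure_minimal ?_ hTc)
    rintro r ⟨hr, hr'⟩
    rcases h.onEdges_cases (hC r ⟨hr.1.le, hr.2.le⟩) with ⟨u, v, -, hy, -⟩ | ⟨u, v, huv, hx, h1, h2⟩
    · exact absurd ⟨u, hy⟩ hr'
    · exact mem_biUnion (x := (u, v)) ⟨huv, hx⟩ ⟨h1, h2⟩
  obtain ⟨e, he, ht'⟩ := mem_iUnion₂.1 (hsub ht)
  exact ⟨e.1, e.2, he.1, he.2, ht'.1, ht'.2⟩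

lemma strip_eq_of_adj (h : ConvexGrid G x y P) {u v : V} (huv : G.Adj u v) (hx : x u = x v) :
    strip (Rightward G y x) u = strip (Rightward G y x) v := by
  rcases lt_trichotomy (y u) (y v) with h1 | h1 | h1
  · exact strip_eq_of_rel ⟨huv, hx, h1⟩
  · rw [h.inj u v hx h1]
  · exact (strip_eq_of_rel ⟨huv.symm, hx.symm, h1⟩).symm

/-- The vertex `u` is at the point with coordinates `s` and `t`, or it is an end of a vertical edge
through that point. -/
def Attached (G : SimpleGraph V) (x y : V → ℝ) (u : V) (s t : ℝ) : Prop :=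
  ∃ v, (v = u ∨ G.Adj u v) ∧ x u = s ∧ x v = s ∧ t ∈ uIcc (y u) (y v)

lemma attached_self (u : V) : Attached G x y u (x u) (y u) :=
  ⟨u, Or.inl rfl, rfl, rfl, left_mem_uIcc⟩

lemma attached_of_rel {u v : V} {t : ℝ} (huv : Rightward G y x u v) (h1 : y u ≤ t)
    (h2 : t ≤ y v) : Attached G x y u (x u) t :=
  ⟨v, Or.inr huv.1, rfl, huv.2.1.symm, mem_uIcc.2 (Or.inl ⟨h1, h2⟩)⟩

lemma Attached.x_eq {u : V} {s t : ℝ} (hu : Attached G x y u s t) : x u = s := by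
  obtain ⟨v, -, h, -⟩ := hu
  exact h

lemma Attached.onEdges (h : ConvexGrid G x y P) {u : V} {s t : ℝ}
    (hu : Attached G x y u s t) : OnEdges G x y s t := by
  obtain ⟨v, rfl | huv, h1, h2, h3⟩ := hu
  · rw [uIcc_self] at h3
    rw [← h1, mem_singleton_iff.1 h3]
    exact h.onEdges_vertex v
  · exact ⟨u, v, huv, by rw [h1, h2, uIcc_self]; rfl, h3⟩

/-- By planarity, two vertical edges through a point coincide or share an end, so any point of a
vertical path determines it. -/
lemma Attached.strip_eq (h : ConvexGrid G x y P) {u u' : V} {s t : ℝ}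
    (hu : Attached G x y u s t) (hu' : Attached G x y u' s t) :
    strip (Rightward G y x) u = strip (Rightward G y x) u' := by
  have aux : ∀ {u u' v' : V}, x u = s → y u = t → G.Adj u' v' → x u' = s → x v' = s →
      t ∈ uIcc (y u') (y v') → strip (Rightward G y x) u = strip (Rightward G y x) u' := by
    intro u u' v' h1 h2 hadj h3 h4 h5
    rcases h.vertex_on_edge (w := u) hadj (by rw [h1, h3, h4, uIcc_self]; rfl) (h2 ▸ h5) with
      rfl | rfl
    · rfl
    · exact (h.strip_eq_of_adj hadj (h3.trans h4.symm)).symm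
  obtain ⟨v, huv, h1, h2, h3⟩ := hu
  obtain ⟨v', huv', h1', h2', h3'⟩ := hu'
  rcases huv with rfl | huv <;> rcases huv' with rfl | huv'
  · rw [uIcc_self, mem_singleton_iff] at h3 h3'
    rw [h.inj v v' (h1.trans h1'.symm) (h3.symm.trans h3')]
  · rw [uIcc_self, mem_singleton_iff] at h3
    exact aux h1 h3.symm huv' h1' h2' h3'
  · rw [uIcc_self, mem_singleton_iff] at h3'
    exact (aux h1' h3'.symm huv h1 h2 h3).symm
  · have e1 := h.strip_eq_of_adj huv (h1.trans h2.symm)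
    have e2 := h.strip_eq_of_adj huv' (h1'.trans h2'.symm)
    have key : ∃ a, a ∈ s(u, v) ∧ a ∈ s(u', v') := by
      by_cases hs : s(u, v) = s(u', v')
      · exact ⟨u, Sym2.mem_mk_left u v, hs ▸ Sym2.mem_mk_left u v⟩
      · obtain ⟨a, a1, a2, -⟩ := h.planar u v u' v' huv huv' hs s t
          (by rw [h1, h2, uIcc_self]; rfl) h3 (by rw [h1', h2', uIcc_self]; rfl) h3'
        exact ⟨a, a1, a2⟩
    obtain ⟨a, a1, a2⟩ := key
    have f1 : strip (Rightward G y x) u = strip (Rightward G y x) a := by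
      rcases Sym2.mem_iff.1 a1 with rfl | rfl
      · rfl
      · exact e1
    have f2 : strip (Rightward G y x) u' = strip (Rightward G y x) a := by
      rcases Sym2.mem_iff.1 a2 with rfl | rfl
      · rfl
      · exact e2
    exact f1.trans f2.symm

/-- A vertical segment contained in the drawing belongs to a single vertical path. -/
lemma column_cover (h : ConvexGrid G x y P) [Finite V] {a c d : ℝ} (hcd : c < d)
    (hC : ∀ t ∈ Icc c d, OnEdges G x y a t) :
    ∃ K, ∀ t ∈ Icc c d, ∃ u v, Rightward G y x u v ∧ x u = a ∧ y u ≤ t ∧ t ≤ y v ∧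
      strip (Rightward G y x) u = K := by
  obtain ⟨u₀, v₀, huv₀, hx₀, h1₀, h2₀⟩ := h.onEdges_column hcd hC (left_mem_Icc.2 hcd.le)
  refine ⟨strip (Rightward G y x) u₀, ?_⟩
  set T : Set (V × V) → Set ℝ := fun S => ⋃ e ∈ S, Icc (y e.1) (y e.2) with hT
  set S₁ : Set (V × V) := {e | Rightward G y x e.1 e.2 ∧ x e.1 = a ∧
    strip (Rightward G y x) e.1 = strip (Rightward G y x) u₀} with hS₁
  set S₂ : Set (V × V) := {e | Rightward G y x e.1 e.2 ∧ x e.1 = a ∧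
    strip (Rightward G y x) e.1 ≠ strip (Rightward G y x) u₀} with hS₂
  have hcl : ∀ S, IsClosed (T S) := fun S => (Set.toFinite S).isClosed_biUnion fun _ _ => isClosed_Icc
  have hcov : Icc c d ⊆ T S₁ ∪ T S₂ := by
    intro t ht
    obtain ⟨u, v, huv, hx, h1, h2⟩ := h.onEdges_column hcd hC ht
    by_cases he : strip (Rightward G y x) u = strip (Rightward G y x) u₀
    · exact Or.inl (mem_biUnion (x := (u, v)) ⟨huv, hx, he⟩ ⟨h1, h2⟩)
    · exact Or.inr (mem_biUnion (x := (u, v)) ⟨huv, hx, he⟩ ⟨h1, h2⟩)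
  intro t ht
  rcases hcov ht with ht' | ht'
  · obtain ⟨e, he, he'⟩ := mem_iUnion₂.1 ht'
    exact ⟨e.1, e.2, he.1, he.2.1, he'.1, he'.2, he.2.2⟩
  · exfalso
    -- The interval is connected and covered by two closed sets, each meeting it, so they have a
    -- common point; there `Attached.strip_eq` identifies the two paths.
    obtain ⟨r, -, hr1, hr2⟩ := isPreconnected_closed_iff.1 (isPreconnected_Icc (a := c) (b := d))
      _ _ (hcl S₁) (hcl S₂) hcov
      ⟨c, left_mem_Icc.2 hcd.le, mem_biUnion (x := (u₀, v₀)) ⟨huv₀, hx₀, rfl⟩ ⟨h1₀, h2₀⟩⟩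
      ⟨t, ht, ht'⟩
    obtain ⟨e, he, he'⟩ := mem_iUnion₂.1 hr1
    obtain ⟨f, hf, hf'⟩ := mem_iUnion₂.1 hr2
    have ha := attached_of_rel he.1 he'.1 he'.2
    have hb := attached_of_rel hf.1 hf'.1 hf'.2
    rw [he.2.1] at ha
    rw [hf.2.1] at hb
    exact hf.2.2 ((hb.strip_eq h ha).trans he.2.2)

/-- A vertex has at most one neighbour on its right and one on its left, so a horizontal path does
not branch and any walk in it reduces to a directed one. -/
lemma strip_chain (h : ConvexGrid G x y P) {u v : V}
    (huv : strip (Rightward G x y) u = strip (Rightward G x y) v) :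
    Relation.ReflTransGen (Rightward G x y) u v ∨ Relation.ReflTransGen (Rightward G x y) v u := by
  refine strip_induction (S := fun w => Relation.ReflTransGen (Rightward G x y) u w ∨
    Relation.ReflTransGen (Rightward G x y) w u) (Or.inl .refl) ?_ huv
  rintro a b (hua | hau) (hab | hba)
  · exact Or.inl (hua.tail hab)
  · rcases Relation.ReflTransGen.cases_tail hua with rfl | ⟨c, huc, hca⟩
    · exact Or.inr (.single hba)
    · rw [← h.rightward_unique' hca hba]
      exact Or.inl huc
  · rcases Relation.ReflTransGen.cases_head hau with rfl | ⟨c, hac, hcu⟩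
    · exact Or.inl (.single hab)
    · rw [← h.rightward_unique hac hab]
      exact Or.inr hcu
  · exact Or.inr (Relation.ReflTransGen.head hba hau)

lemma le_of_chain {u v : V} (huv : Relation.ReflTransGen (Rightward G x y) u v) :
    x u ≤ x v ∧ y u = y v ∧ (u = v ∨ Prec (Rightward G x y) (Rightward G y x) u v) := by
  induction huv with
  | refl => exact ⟨le_rfl, rfl, Or.inl rfl⟩
  | tail _ hbc ih =>
    refine ⟨ih.1.trans hbc.2.2.le, ih.2.1.trans hbc.2.1, Or.inr ?_⟩
    rcases ih.2.2 with rfl | hp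
    · exact Prec.of_rel hbc
    · exact hp.trans (Prec.of_rel hbc)

lemma prec_of_strip_eq (h : ConvexGrid G x y P) {u v : V}
    (huv : strip (Rightward G x y) u = strip (Rightward G x y) v) (hx : x u < x v) :
    Prec (Rightward G x y) (Rightward G y x) u v := by
  rcases h.strip_chain huv with hc | hc
  · rcases (le_of_chain hc).2.2 with rfl | hp
    · exact absurd hx (lt_irrefl _)
    · exact hp
  · exact absurd (le_of_chain hc).1 hx.not_ge

lemma prec_lt {u v : V} (huv : Prec (Rightward G x y) (Rightward G y x) u v) : x u < x v :=
  huv.lt (fun _ _ h => h.2.2) fun _ _ h => h.2.1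

lemma x_eq_of_strip_eq {u v : V}
    (huv : strip (Rightward G y x) u = strip (Rightward G y x) v) : x u = x v :=
  eq_of_strip_eq (fun _ _ h => h.2.1) huv

lemma exists_corner (h : ConvexGrid G x y P) {a t : ℝ} {u v w z : V}
    (huv : Rightward G x y u v) (hwz : Rightward G y x w z) (h1 : y u = t) (h2 : x w = a)
    (h3 : x u ≤ a) (h4 : a ≤ x v) (h5 : y w ≤ t) (h6 : t ≤ y z) :
    ∃ p, x p = a ∧ y p = t ∧ strip (Rightward G y x) p = strip (Rightward G y x) w ∧
      strip (Rightward G x y) p = strip (Rightward G x y) u := by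
  subst h1 h2
  obtain ⟨p, h7, h8, h9, h10⟩ := h.crossing huv hwz h3 h4 h5 h6
  refine ⟨p, h9, h10, ?_, ?_⟩
  · rcases h8 with rfl | rfl
    · rfl
    · exact (strip_eq_of_rel hwz).symm
  · rcases h7 with rfl | rfl
    · rfl
    · exact (strip_eq_of_rel huv).symm

/-- An internal face is a rectangle whose lower corners are vertices and whose left and right sides
are on two vertical paths, the first of which precedes the second. -/
lemma exists_cell (h : ConvexGrid G x y P) [Finite V] {s t : ℝ} (hP : P s t)
    (hC : ¬ OnEdges G x y s t) :
    ∃ a b c d, s ∈ Ioo a b ∧ t ∈ Ioo c d ∧ (∀ p ∈ Ioo a b, ∀ q ∈ Ioo c d, ¬ OnEdges G x y p q) ∧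
      ∃ p q, x p = a ∧ y p = c ∧ x q = b ∧ y q = c ∧
        Prec (Rightward G x y) (Rightward G y x) p q ∧
        (∀ r ∈ Icc c d, ∃ u, Attached G x y u a r ∧
          strip (Rightward G y x) u = strip (Rightward G y x) p) ∧
        (∀ r ∈ Icc c d, ∃ u, Attached G x y u b r ∧
          strip (Rightward G y x) u = strip (Rightward G y x) q) := by
  obtain ⟨a, b, c, d, hs, ht, hR, hlr, hbt⟩ := h.face s t hP hC
  have hab : a < b := hs.1.trans hs.2
  have hcd : c < d := ht.1.trans ht.2
  refine ⟨a, b, c, d, hs, ht, hR, ?_⟩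
  obtain ⟨K₁, hK₁⟩ := h.column_cover hcd fun q hq => (hlr q hq).1
  obtain ⟨K₂, hK₂⟩ := h.column_cover hcd fun q hq => (hlr q hq).2
  -- The lower side lies on a single horizontal path; the vertices where it meets the two vertical
  -- sides are therefore ordered by `prec_of_strip_eq`.
  obtain ⟨K, hK⟩ := h.swap.column_cover hab fun p hp => onEdges_swap.2 (hbt p hp).1
  obtain ⟨w₁, z₁, a1, a2, a3, a4, a5⟩ := hK₁ c (left_mem_Icc.2 hcd.le)
  obtain ⟨w₂, z₂, b1, b2, b3, b4, b5⟩ := hK₂ c (left_mem_Icc.2 hcd.le)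
  obtain ⟨u₁, v₁, c1, c2, c3, c4, c5⟩ := hK a (left_mem_Icc.2 hab.le)
  obtain ⟨u₂, v₂, d1, d2, d3, d4, d5⟩ := hK b (right_mem_Icc.2 hab.le)
  obtain ⟨p, p1, p2, p3, p4⟩ := h.exists_corner c1 a1 c2 a2 c3 c4 a3 a4
  obtain ⟨q, q1, q2, q3, q4⟩ := h.exists_corner d1 b1 d2 b2 d3 d4 b3 b4
  refine ⟨p, q, p1, p2, q1, q2, h.prec_of_strip_eq ?_ (by rw [p1, q1]; exact hab), ?_, ?_⟩
  · rw [p4, q4, c5, d5]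
  · intro r hr
    obtain ⟨u, v, e1, e2, e3, e4, e5⟩ := hK₁ r hr
    exact ⟨u, e2 ▸ attached_of_rel e1 e3 e4, by rw [e5, p3, a5]⟩
  · intro r hr
    obtain ⟨u, v, e1, e2, e3, e4, e5⟩ := hK₂ r hr
    exact ⟨u, e2 ▸ attached_of_rel e1 e3 e4, by rw [e5, q3, b5]⟩

/-- A vertical path can meet a horizontal edge only at an end of that edge, and the right end is too
far away. -/
lemma Attached.x_eq_of_rightward (h : ConvexGrid G x y P) {u a b : V} {s t : ℝ}
    (hu : Attached G x y u s t) (hab : Rightward G x y a b) (hy : y a = t) (h1 : x a ≤ s)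
    (h2 : s < x b) : x a = s := by
  obtain ⟨v, rfl | huv, h3, h4, h5⟩ := hu
  · rw [uIcc_self, mem_singleton_iff] at h5
    rcases h.vertex_on_rightward (w := v) hab (by rw [h3]; exact h1) (by rw [h3]; exact h2.le)
      (h5.symm.trans hy.symm) with rfl | rfl
    · exact h3
    · exact absurd h3 h2.ne'
  · have hne : s(a, b) ≠ s(u, v) := by
      intro hs
      have := hab.2.2
      rcases Sym2.eq_iff.1 hs with ⟨rfl, rfl⟩ | ⟨rfl, rfl⟩ <;> linarith
    obtain ⟨w, w1, -, w2, -⟩ := h.planar a b u v hab.1 huv hne s t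
      (mem_uIcc.2 (Or.inl ⟨h1, h2.le⟩)) (hy ▸ left_mem_uIcc) (by rw [h3, h4, uIcc_self]; rfl) h5
    rcases Sym2.mem_iff.1 w1 with rfl | rfl
    · exact w2
    · exact absurd w2 h2.ne'

/-- Oriented so that the induction hypothesis concerns vertices with a larger value of `f`. -/
lemma wellFounded_coord [Finite V] (f : V → ℝ) : WellFounded fun a b : V => f b < f a :=
  @Finite.wellFounded_of_trans_of_irrefl V _ _
    ⟨fun _ _ _ h h' => lt_trans h' h⟩ ⟨fun _ => lt_irrefl _⟩

/-- Of two vertical paths met by a horizontal line, the left one precedes the right one. -/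
theorem prec_of_horizontal (h : ConvexGrid G x y P) [Finite V] {t s' : ℝ} {v : V}
    (hv : Attached G x y v s' t) : ∀ (u : V) (s : ℝ), Attached G x y u s t → s < s' →
    Prec (Rightward G x y) (Rightward G y x) u v := by
  intro u
  induction u using (wellFounded_coord x).induction with
  | _ u ih =>
  intro s hu hss
  -- It suffices to reach a later vertical path that meets the line no further right than $v$ does.
  have hcase : ∀ u' r, Attached G x y u' r t → r ≤ s' → x u < x u' →
      Prec (Rightward G x y) (Rightward G y x) u u' →
      Prec (Rightward G x y) (Rightward G y x) u v := by
    intro u' r hu' hr hlt hp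
    rcases hr.lt_or_eq with hr | rfl
    · exact hp.trans (ih u' hlt r hu' hr)
    · exact hp.congr rfl (hu'.strip_eq h hv)
  by_cases hE : ∃ a b, Rightward G x y a b ∧ y a = t ∧ x a = s
  · obtain ⟨a, b, hab, hya, hxa⟩ := hE
    have hA : Attached G x y a s t := by
      rw [← hya, ← hxa]
      exact attached_self a
    refine hcase b (x b) ?_ ?_ ?_ ((Prec.of_rel hab).congr (hA.strip_eq h hu) rfl)
    · rw [← hya, hab.2.1]
      exact attached_self b
    · by_contra! hlt
      have := hv.x_eq_of_rightward h hab hya (hxa.trans_le hss.le) hlt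
      linarith
    · rw [hu.x_eq, ← hxa]
      exact hab.2.2
  · obtain ⟨ε, hε, hloc⟩ := exists_local G x y s t
    have hfree : ∀ r, s < r → r < s + ε → ¬ OnEdges G x y r t := by
      intro r h1 h2 hC
      obtain ⟨a, b, hab, e1, e2, e3, e4⟩ := hloc r t (by rw [abs_lt]; constructor <;> linarith)
        (by simpa using hε) hC
      obtain ⟨a, b, hab, e1, e2, e3⟩ := h.exists_rightward_of_mem hab h1 e1 e3 e2
      exact hE ⟨a, b, hab, e1, hu.x_eq_of_rightward h hab e1 e2 (h1.trans_le e3)⟩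
    obtain ⟨z, hz1, hz2⟩ := exists_between (lt_min hss (lt_add_of_pos_right s hε))
    have hPz : P z t := h.hconvex s s' z t (h.region _ _ (hu.onEdges h))
      (h.region _ _ (hv.onEdges h)) hz1.le (hz2.le.trans (min_le_left _ _))
    obtain ⟨a, b, c, d, hz, ht, hR, p, q, -, -, -, -, hpq, hl, hr⟩ :=
      h.exists_cell hPz (hfree z hz1 (hz2.trans_le (min_le_right _ _)))
    obtain ⟨ul, hul, hulp⟩ := hl t ⟨ht.1.le, ht.2.le⟩
    obtain ⟨ur, hur, hurq⟩ := hr t ⟨ht.1.le, ht.2.le⟩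
    -- Between the path of $u$ and the point $z$ the line is free of edges, so the face containing
    -- $z$ has its left side on that path.
    have has : a = s := by
      apply le_antisymm
      · by_contra! hlt
        exact hfree a hlt ((hz.1.trans hz2).trans_le (min_le_right _ _)) (hul.onEdges h)
      · by_contra! hlt
        exact hR s ⟨hlt, hz1.trans hz.2⟩ t ht (hu.onEdges h)
    subst has
    refine hcase ur b hur ?_ ?_ (hpq.congr (hulp.symm.trans (hul.strip_eq h hu)) hurq.symm)
    · by_contra! hlt
      exact hR s' ⟨hss, hlt⟩ t ht (hv.onEdges h)
    · rw [hu.x_eq, hur.x_eq]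
      exact hz1.trans hz.2

/-- Near $s$ the closed upper right quadrant meets no edge except at $s$. If the region extended to
the right of $s$, the face just to the right would have its left side in this quadrant, continuing
above the height of $s$. -/
lemma not_region_right (h : ConvexGrid G x y P) [Finite V] {s : V}
    (h1 : ∀ w, ¬ Rightward G x y s w) (h2 : ∀ w, ¬ Rightward G y x s w) {r : ℝ} (hr : x s < r) :
    ¬ P r (y s) := by
  intro hP
  obtain ⟨ε, hε, hloc⟩ := exists_local G x y (x s) (y s)
  have hfree : ∀ p q, x s ≤ p → p < x s + ε → y s ≤ q → q < y s + ε → x s < p ∨ y s < q →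
      ¬ OnEdges G x y p q := by
    intro p q e1 e2 e3 e4 e5 hC
    obtain ⟨u, v, huv, f1, f2, f3, f4⟩ := hloc p q (by rw [abs_lt]; constructor <;> linarith)
      (by rw [abs_lt]; constructor <;> linarith) hC
    have key : ∀ w, G.Adj s w → p ∈ uIcc (x s) (x w) → q ∈ uIcc (y s) (y w) → False := by
      intro w hw g1 g2
      rw [mem_uIcc] at g1 g2
      rcases h.adj_cases hw with g | g | g | g
      · exact h1 w g
      · have := g.2.1
        have := g.2.2
        rcases e5 with e5 | e5 <;> rcases g1 with g1 | g1 <;> rcases g2 with g2 | g2 <;> linarith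
      · exact h2 w g
      · have := g.2.1
        have := g.2.2
        rcases e5 with e5 | e5 <;> rcases g1 with g1 | g1 <;> rcases g2 with g2 | g2 <;> linarith
    rcases h.vertex_on_edge huv f1 f2 with rfl | rfl
    · exact key v huv f3 f4
    · exact key u huv.symm (uIcc_comm (x u) _ ▸ f3) (uIcc_comm (y u) _ ▸ f4)
  obtain ⟨z, hz1, hz2⟩ := exists_between (lt_min hr (lt_add_of_pos_right (x s) hε))
  have hz3 := hz2.trans_le (min_le_right _ _)
  have hPz : P z (y s) := h.hconvex (x s) r z (y s) (h.region _ _ (h.onEdges_vertex s)) hP hz1.le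
    (hz2.le.trans (min_le_left _ _))
  obtain ⟨a, b, c, d, hz, ht, hR, hlr, -⟩ := h.face z (y s) hPz
    (hfree z (y s) hz1.le hz3 le_rfl (by linarith) (Or.inl hz1))
  have has : x s ≤ a := by
    by_contra! hlt
    exact hR (x s) ⟨hlt, hz1.trans hz.2⟩ (y s) ht (h.onEdges_vertex s)
  obtain ⟨q, hq1, hq2⟩ := exists_between (lt_min ht.2 (lt_add_of_pos_right (y s) hε))
  exact hfree a q has (hz.1.trans hz3) hq1.le (hq2.trans_le (min_le_right _ _)) (Or.inr hq1)
    (hlr q ⟨(ht.1.trans hq1).le, (hq2.trans_le (min_le_left _ _)).le⟩).1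

/-- A vertex without an edge to the right or upwards has no other vertex in its closed upper right
quadrant. -/
theorem quadrant_empty (h : ConvexGrid G x y P) [Finite V] {s : V}
    (h1 : ∀ w, ¬ Rightward G x y s w) (h2 : ∀ w, ¬ Rightward G y x s w) {v : V} (hx : x s ≤ x v)
    (hy : y s ≤ y v) : v = s := by
  have hr : ∀ r, x s < r → ¬ OnEdges G x y r (y s) := fun r hr hC =>
    h.not_region_right h1 h2 hr (h.region _ _ hC)
  have hu : ∀ r, y s < r → ¬ OnEdges G x y (x s) r := fun r hr hC =>
    h.swap.not_region_right h2 h1 hr (h.region _ _ hC)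
  -- The rays from $s$ to the right and upwards avoid all edges, so no edge enters the closed
  -- quadrant from outside or from $s$; connectedness does the rest.
  have step : ∀ a b, G.Adj a b → (a = s ∨ x a < x s ∨ y a < y s) →
      (b = s ∨ x b < x s ∨ y b < y s) := by
    intro a b hab ha
    by_contra! hb
    obtain ⟨hbs, hbx, hby⟩ := hb
    rcases h.adj_cases hab with g | g | g | g
    · have e1 := g.2.1
      have e2 := g.2.2
      rcases ha with rfl | ha | ha
      · exact h1 b g
      · rcases hby.lt_or_eq with hlt | heq
        · exact hu (y b) hlt ⟨a, b, hab, mem_uIcc.2 (Or.inl ⟨ha.le, hbx⟩), right_mem_uIcc⟩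
        · rcases hbx.lt_or_eq with hlt | heq'
          · exact hr (x b) hlt (heq ▸ h.onEdges_vertex b)
          · exact hbs (h.inj _ _ heq'.symm heq.symm)
      · linarith
    · have e1 := g.2.1
      have e2 := g.2.2
      rcases ha with rfl | ha | ha
      · linarith
      · linarith
      · linarith
    · have e1 := g.2.1
      have e2 := g.2.2
      rcases ha with rfl | ha | ha
      · exact h2 b g
      · linarith
      · rcases hbx.lt_or_eq with hlt | heq
        · exact hr (x b) hlt ⟨a, b, hab, right_mem_uIcc, mem_uIcc.2 (Or.inl ⟨ha.le, hby⟩)⟩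
        · rcases hby.lt_or_eq with hlt | heq'
          · exact hu (y b) hlt (heq ▸ h.onEdges_vertex b)
          · exact hbs (h.inj _ _ heq.symm heq'.symm)
    · have e1 := g.2.1
      have e2 := g.2.2
      rcases ha with rfl | ha | ha
      · linarith
      · linarith
      · linarith
  obtain ⟨p⟩ := h.preconnected s v
  have hwalk : ∀ {a b : V} (_ : G.Walk a b), (a = s ∨ x a < x s ∨ y a < y s) →
      (b = s ∨ x b < x s ∨ y b < y s) := by
    intro a b p
    induction p with
    | nil => exact id
    | cons hadj _ ih => exact fun ha => ih (step _ _ hadj ha)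
  rcases hwalk p (Or.inl rfl) with h3 | h3 | h3
  · exact h3
  · exact absurd hx h3.not_ge
  · exact absurd hy h3.not_ge

/-- Of two vertices one of which is above and to the right of the other, the first precedes the
second in one of the two orders. -/
theorem prec_or_prec_of_lt (h : ConvexGrid G x y P) [Finite V] {b : V} : ∀ a : V, x a < x b →
    y a < y b → Prec (Rightward G x y) (Rightward G y x) a b ∨
      Prec (Rightward G y x) (Rightward G x y) a b := by
  intro a
  induction a using (wellFounded_coord fun a => x a + y a).induction with
  | _ a ih =>
  intro hx hy
  have hex : (∃ w, Rightward G x y a w) ∨ ∃ w, Rightward G y x a w := by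
    by_contra! hcon
    have := h.quadrant_empty hcon.1 hcon.2 hx.le hy.le
    rw [this] at hx
    exact lt_irrefl _ hx
  rcases hex with ⟨w, hw⟩ | ⟨w, hw⟩
  · have e1 := hw.2.1
    have e2 := hw.2.2
    rcases lt_or_ge (x w) (x b) with hlt | hge
    · refine (ih w (by linarith) hlt (by linarith)).imp (Prec.of_rel hw).trans fun hp => ?_
      exact hp.congr (strip_eq_of_rel hw).symm rfl
    -- The edge passes below $b$, so the vertical line through $b$ meets it, and the rows are
    -- ordered in $D_y$.
    · right
      refine h.swap.prec_of_horizontal (t := x b) (s' := y b) (attached_self b) a (y a) ?_ hy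
      exact attached_of_rel hw hx.le hge
  · have e1 := hw.2.1
    have e2 := hw.2.2
    rcases lt_or_ge (y w) (y b) with hlt | hge
    · refine (ih w (by linarith) (by linarith) hlt).imp (fun hp => ?_) (Prec.of_rel hw).trans
      exact hp.congr (strip_eq_of_rel hw).symm rfl
    · left
      refine h.prec_of_horizontal (t := y b) (s' := x b) (attached_self b) a (x a) ?_ hx
      exact attached_of_rel hw hy.le hge

end ConvexGrid

/-! ### Changing coordinates, and the failure of greediness caused by a conflict. -/

namespace ConvexGrid

variable {V : Type*} {G : SimpleGraph V} {x y : V → ℝ} {P : ℝ → ℝ → Prop}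

theorem prec_or_prec_of_lt_of_gt (h : ConvexGrid G x y P) [Finite V] {a b : V} (hx : x a < x b)
    (hy : y b < y a) : Prec (Rightward G x y) (Rightward G y x) a b ∨
      Prec (Rightward G y x) (Rightward G x y) b a := by
  have := h.swap.neg.swap.prec_or_prec_of_lt a hx (neg_lt_neg hy)
  rwa [rightward_neg_right, rightward_neg_left, prec_flip_right, prec_flip_left] at this

/-- Two distinct vertices are comparable in one of the two orders. -/
theorem comparable_of_ne (h : ConvexGrid G x y P) [Finite V] {u v : V} (huv : u ≠ v) :
    (Prec (Rightward G x y) (Rightward G y x) u v ∨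
      Prec (Rightward G x y) (Rightward G y x) v u) ∨
    (Prec (Rightward G y x) (Rightward G x y) u v ∨
      Prec (Rightward G y x) (Rightward G x y) v u) := by
  have key : ∀ u v, u ≠ v → x u ≤ x v → Prec (Rightward G x y) (Rightward G y x) u v ∨
    (Prec (Rightward G y x) (Rightward G x y) u v ∨
      Prec (Rightward G y x) (Rightward G x y) v u) := by
    intro u v huv hx
    rcases hx.lt_or_eq with hx | hx
    · rcases lt_trichotomy (y u) (y v) with hy | hy | hy
      · exact (h.prec_or_prec_of_lt u hx hy).imp_right Or.inl
      · exact Or.inl (h.prec_of_horizontal (attached_self v) u (x u) (hy ▸ attached_self u) hx)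
      · exact (h.prec_or_prec_of_lt_of_gt hx hy).imp_right Or.inr
    · right
      rcases lt_trichotomy (y u) (y v) with hy | hy | hy
      · exact Or.inl (h.swap.prec_of_horizontal (attached_self v) u (y u) (hx ▸ attached_self u) hy)
      · exact absurd (h.inj u v hx hy) huv
      · exact Or.inr (h.swap.prec_of_horizontal (attached_self u) v (y v) (hx ▸ attached_self v) hy)
  rcases le_total (x u) (x v) with hx | hx
  · rcases key u v huv hx with h1 | h1
    · exact Or.inl (Or.inl h1)
    · exact Or.inr h1
  · rcases key v u huv.symm hx with h1 | h1
    · exact Or.inl (Or.inr h1)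
    · exact Or.inr h1.symm

/-- Coordinates `X` and `Y` that respect the prescribed direction of every edge. -/
structure Respects (L B : V → V → Prop) (X Y : V → ℝ) : Prop where
  x_lt : ∀ p q, L p q → X p < X q
  x_eq : ∀ p q, B p q → X p = X q
  y_lt : ∀ p q, B p q → Y p < Y q
  y_eq : ∀ p q, L p q → Y p = Y q

lemma Respects.swap {L B : V → V → Prop} {X Y : V → ℝ} (hr : Respects L B X Y) :
    Respects B L Y X :=
  ⟨hr.y_lt, hr.y_eq, hr.x_lt, hr.x_eq⟩

lemma Respects.bounds {L B : V → V → Prop} {X Y : V → ℝ} (hr : Respects L B X Y) {l r : V}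
    (h : L l r ∨ B l r) : X l ≤ X r ∧ Y l ≤ Y r := by
  rcases h with h | h
  · exact ⟨(hr.x_lt _ _ h).le, (hr.y_eq _ _ h).le⟩
  · exact ⟨(hr.x_eq _ _ h).le, (hr.y_lt _ _ h).le⟩

lemma respects_self : Respects (Rightward G x y) (Rightward G y x) x y :=
  ⟨fun _ _ h => h.2.2, fun _ _ h => h.2.1, fun _ _ h => h.2.2, fun _ _ h => h.2.1⟩

variable {X Y : V → ℝ}

/-- If two edges are separated by a vertical line, they remain separated in all coordinates that
respect the directions. -/
lemma separated (h : ConvexGrid G x y P) [Finite V]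
    (hr : Respects (Rightward G x y) (Rightward G y x) X Y) {l r l' r' : V}
    (he : Rightward G x y l r ∨ Rightward G y x l r)
    (hf : Rightward G x y l' r' ∨ Rightward G y x l' r') (hlt : x r < x l') :
    X r < X l' ∨ Y r < Y l' ∨ Y r' < Y l := by
  have toX : ∀ {p q}, Prec (Rightward G x y) (Rightward G y x) p q → X p < X q :=
    fun hp => hp.lt hr.x_lt hr.x_eq
  have toY : ∀ {p q}, Prec (Rightward G y x) (Rightward G x y) p q → Y p < Y q :=
    fun hp => hp.lt hr.y_lt hr.y_eq
  have b1 := respects_self.bounds he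
  have b2 := respects_self.bounds hf
  rcases lt_or_ge (y r') (y l) with h1 | h1
  -- The bounding box of an edge is degenerate, so its lower right corner is an end of the edge, as
  -- is the upper left corner for the other edge.
  · have hp : ∃ p, x p = x r ∧ y p = y l ∧ X p = X r ∧ Y p = Y l := by
      rcases he with he | he
      · exact ⟨r, rfl, he.2.1.symm, rfl, (hr.y_eq _ _ he).symm⟩
      · exact ⟨l, he.2.1, rfl, hr.x_eq _ _ he, rfl⟩
    have hq : ∃ q, x q = x l' ∧ y q = y r' ∧ X q = X l' ∧ Y q = Y r' := by
      rcases hf with hf | hf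
      · exact ⟨l', rfl, hf.2.1, rfl, hr.y_eq _ _ hf⟩
      · exact ⟨r', hf.2.1.symm, rfl, (hr.x_eq _ _ hf).symm, rfl⟩
    obtain ⟨p, p1, p2, p3, p4⟩ := hp
    obtain ⟨q, q1, q2, q3, q4⟩ := hq
    rcases h.prec_or_prec_of_lt_of_gt (a := p) (b := q) (by rwa [p1, q1]) (by rwa [p2, q2]) with
      hh | hh
    · have := toX hh
      exact Or.inl (by rwa [p3, q3] at this)
    · have := toY hh
      exact Or.inr (Or.inr (by rwa [p4, q4] at this))
  · rcases lt_or_ge (y r) (y l') with h2 | h2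
    · rcases h.prec_or_prec_of_lt r hlt h2 with hh | hh
      · exact Or.inl (toX hh)
      · exact Or.inr (Or.inl (toY hh))
    · left
      -- The height ranges overlap; the horizontal line at the larger of the two lower ends meets
      -- both edges.
      have ha : Attached G x y r (x r) (max (y l) (y l')) := by
        rcases he with he | he
        · rw [max_eq_left (h2.trans he.2.1.ge), he.2.1]
          exact attached_self r
        · exact ⟨l, Or.inr he.1.symm, rfl, he.2.1,
            mem_uIcc.2 (Or.inr ⟨le_max_left _ _, max_le he.2.2.le h2⟩)⟩
      have hb : Attached G x y l' (x l') (max (y l) (y l')) := by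
        rcases hf with hf | hf
        · rw [max_eq_right (h1.trans hf.2.1.ge)]
          exact attached_self l'
        · exact attached_of_rel hf (le_max_right _ _) (max_le h1 hf.2.2.le)
      exact toX (h.prec_of_horizontal hb r (x r) ha hlt)

lemma exists_oriented (h : ConvexGrid G x y P) {u v : V} (huv : G.Adj u v) :
    ∃ l r, s(l, r) = s(u, v) ∧ (Rightward G x y l r ∨ Rightward G y x l r) := by
  rcases h.adj_cases huv with g | g | g | g
  · exact ⟨u, v, rfl, Or.inl g⟩
  · exact ⟨v, u, Sym2.eq_swap, Or.inl g⟩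
  · exact ⟨u, v, rfl, Or.inr g⟩
  · exact ⟨v, u, Sym2.eq_swap, Or.inr g⟩

/-- The two edges leave $a$ in different directions, since each direction holds at most one
neighbour, and the new coordinates keep these directions. -/
lemma meet_at_common_end (h : ConvexGrid G x y P)
    (hr : Respects (Rightward G x y) (Rightward G y x) X Y) {a b c : V} (hab : G.Adj a b)
    (hac : G.Adj a c) (hbc : b ≠ c) {s t : ℝ} (h1 : s ∈ uIcc (X a) (X b))
    (h2 : t ∈ uIcc (Y a) (Y b)) (h3 : s ∈ uIcc (X a) (X c)) (h4 : t ∈ uIcc (Y a) (Y c)) :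
    X a = s ∧ Y a = t := by
  have key : ∀ b, G.Adj a b → s ∈ uIcc (X a) (X b) → t ∈ uIcc (Y a) (Y b) →
      (Rightward G x y a b ∧ X a ≤ s ∧ Y a = t) ∨ (Rightward G x y b a ∧ s ≤ X a ∧ Y a = t) ∨
      (Rightward G y x a b ∧ X a = s ∧ Y a ≤ t) ∨ (Rightward G y x b a ∧ X a = s ∧ t ≤ Y a) := by
    intro b hab h1 h2
    rcases h.adj_cases hab with g | g | g | g
    · rw [← hr.y_eq _ _ g, uIcc_self, mem_singleton_iff] at h2
      rw [uIcc_of_le (hr.x_lt _ _ g).le] at h1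
      exact Or.inl ⟨g, h1.1, h2.symm⟩
    · rw [hr.y_eq _ _ g, uIcc_self, mem_singleton_iff] at h2
      rw [uIcc_of_ge (hr.x_lt _ _ g).le] at h1
      exact Or.inr (Or.inl ⟨g, h1.2, h2.symm⟩)
    · rw [← hr.x_eq _ _ g, uIcc_self, mem_singleton_iff] at h1
      rw [uIcc_of_le (hr.y_lt _ _ g).le] at h2
      exact Or.inr (Or.inr (Or.inl ⟨g, h1.symm, h2.1⟩))
    · rw [hr.x_eq _ _ g, uIcc_self, mem_singleton_iff] at h1
      rw [uIcc_of_ge (hr.y_lt _ _ g).le] at h2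
      exact Or.inr (Or.inr (Or.inr ⟨g, h1.symm, h2.2⟩))
  rcases key b hab h1 h2 with ⟨g, e1, e2⟩ | ⟨g, e1, e2⟩ | ⟨g, e1, e2⟩ | ⟨g, e1, e2⟩ <;>
    rcases key c hac h3 h4 with ⟨g', e1', e2'⟩ | ⟨g', e1', e2'⟩ | ⟨g', e1', e2'⟩ | ⟨g', e1', e2'⟩
  · exact absurd (h.rightward_unique g g') hbc
  · exact ⟨le_antisymm e1 e1', e2⟩
  · exact ⟨e1', e2⟩
  · exact ⟨e1', e2⟩
  · exact ⟨le_antisymm e1' e1, e2⟩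
  · exact absurd (h.rightward_unique' g g') hbc
  · exact ⟨e1', e2⟩
  · exact ⟨e1', e2⟩
  · exact ⟨e1, e2'⟩
  · exact ⟨e1, e2'⟩
  · exact absurd (h.swap.rightward_unique g g') hbc
  · exact ⟨e1, le_antisymm e2 e2'⟩
  · exact ⟨e1, e2'⟩
  · exact ⟨e1, e2'⟩
  · exact ⟨e1, le_antisymm e2' e2⟩
  · exact absurd (h.swap.rightward_unique' g g') hbc

/-- All coordinates that respect the directions give a planar drawing. -/
theorem planar_of_respects (h : ConvexGrid G x y P) [Finite V]
    (hr : Respects (Rightward G x y) (Rightward G y x) X Y) {u v w z : V} (huv : G.Adj u v)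
    (hwz : G.Adj w z) (hne : s(u, v) ≠ s(w, z)) {s t : ℝ} (h1 : s ∈ uIcc (X u) (X v))
    (h2 : t ∈ uIcc (Y u) (Y v)) (h3 : s ∈ uIcc (X w) (X z)) (h4 : t ∈ uIcc (Y w) (Y z)) :
    ∃ a, a ∈ s(u, v) ∧ a ∈ s(w, z) ∧ X a = s ∧ Y a = t := by
  by_cases hcom : ∃ a, a ∈ s(u, v) ∧ a ∈ s(w, z)
  · obtain ⟨a, ha, ha'⟩ := hcom
    refine ⟨a, ha, ha', ?_⟩
    rcases Sym2.mem_iff.1 ha with rfl | rfl <;> rcases Sym2.mem_iff.1 ha' with rfl | rfl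
    · exact h.meet_at_common_end hr huv hwz (fun e => hne (by rw [e])) h1 h2 h3 h4
    · rw [uIcc_comm] at h3 h4
      exact h.meet_at_common_end hr huv hwz.symm (fun e => hne (by rw [e, Sym2.eq_swap]))
        h1 h2 h3 h4
    · rw [uIcc_comm] at h1 h2
      exact h.meet_at_common_end hr huv.symm hwz (fun e => hne (by rw [e, Sym2.eq_swap]))
        h1 h2 h3 h4
    · rw [uIcc_comm] at h1 h2 h3 h4
      exact h.meet_at_common_end hr huv.symm hwz.symm (fun e => hne (by rw [e])) h1 h2 h3 h4
  · exfalso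
    obtain ⟨l, r, hlr, he⟩ := h.exists_oriented huv
    obtain ⟨l', r', hlr', hf⟩ := h.exists_oriented hwz
    have box : ∀ {f : V → ℝ} {p q p' q' : V}, s(p, q) = s(p', q') → f p ≤ f q →
        uIcc (f p') (f q') = Icc (f p) (f q) := by
      intro f p q p' q' hs hle
      rcases Sym2.eq_iff.1 hs with ⟨rfl, rfl⟩ | ⟨rfl, rfl⟩
      · exact uIcc_of_le hle
      · exact uIcc_of_ge hle
    have b1 := hr.bounds he
    have b2 := hr.bounds hf
    have c1 := respects_self.bounds he
    have c2 := respects_self.bounds hf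
    rw [box hlr b1.1] at h1
    rw [box hlr b1.2] at h2
    rw [box hlr' b2.1] at h3
    rw [box hlr' b2.2] at h4
    -- Edges without a common end are disjoint in the given drawing. Since they are boxes, an
    -- axis-parallel line separates them, and `separated` carries this over to the new coordinates.
    have hdisj : x r < x l' ∨ x r' < x l ∨ y r < y l' ∨ y r' < y l := by
      by_contra! hcon
      obtain ⟨d1, d2, d3, d4⟩ := hcon
      obtain ⟨a, a1, a2, -⟩ := h.planar u v w z huv hwz hne (max (x l) (x l')) (max (y l) (y l'))
        (by rw [box hlr c1.1]; exact ⟨le_max_left _ _, max_le c1.1 d1⟩)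
        (by rw [box hlr c1.2]; exact ⟨le_max_left _ _, max_le c1.2 d3⟩)
        (by rw [box hlr' c2.1]; exact ⟨le_max_right _ _, max_le d2 c2.1⟩)
        (by rw [box hlr' c2.2]; exact ⟨le_max_right _ _, max_le d4 c2.2⟩)
      exact hcom ⟨a, a1, a2⟩
    rcases hdisj with hd | hd | hd | hd
    · rcases h.separated hr he hf hd with e | e | e <;> linarith [h1.1, h1.2, h2.1, h2.2, h3.1, h3.2, h4.1, h4.2]
    · rcases h.separated hr hf he hd with e | e | e <;> linarith [h1.1, h1.2, h2.1, h2.2, h3.1, h3.2, h4.1, h4.2]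
    · rcases h.swap.separated hr.swap he.symm hf.symm hd with e | e | e <;>
        linarith [h1.1, h1.2, h2.1, h2.2, h3.1, h3.2, h4.1, h4.2]
    · rcases h.swap.separated hr.swap hf.symm he.symm hd with e | e | e <;>
        linarith [h1.1, h1.2, h2.1, h2.2, h3.1, h3.2, h4.1, h4.2]

theorem injective_of_respects (h : ConvexGrid G x y P) [Finite V]
    (hr : Respects (Rightward G x y) (Rightward G y x) X Y) {u v : V} (hX : X u = X v)
    (hY : Y u = Y v) : u = v := by
  by_contra hne
  rcases h.comparable_of_ne hne with (hp | hp) | (hp | hp)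
  · exact absurd hX (hp.lt hr.x_lt hr.x_eq).ne
  · exact absurd hX (hp.lt hr.x_lt hr.x_eq).ne'
  · exact absurd hY (hp.lt hr.y_lt hr.y_eq).ne
  · exact absurd hY (hp.lt hr.y_lt hr.y_eq).ne'

/-- Raising a coordinate on an upward closed set of vertices. -/
lemma exists_raise {L B : V → V → Prop} {f : V → ℝ} (hL : ∀ p q, L p q → f p < f q)
    (hB : ∀ p q, B p q → f p = f q) (U : V → Prop) (hUL : ∀ p q, L p q → U p → U q)
    (hUB : ∀ p q, B p q → (U p ↔ U q)) {δ : ℝ} (hδ : 0 ≤ δ) :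
    ∃ F : V → ℝ, (∀ p q, L p q → F p < F q) ∧ (∀ p q, B p q → F p = F q) ∧
      (∀ p, U p → F p = f p + δ) ∧ ∀ p, ¬ U p → F p = f p := by
  classical
  refine ⟨fun p => f p + if U p then δ else 0, fun p q hpq => ?_, fun p q hpq => ?_,
    fun p hp => by simp [hp], fun p hp => by simp [hp]⟩
  · have h1 := hL p q hpq
    by_cases hp : U p
    · simp only [hp, hUL p q hpq hp, if_true]
      linarith
    · by_cases hq : U q <;> simp only [hp, hq, if_true, if_false] <;> linarith
  · simp only [hB p q hpq, hUB p q hpq]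

/-- Two incomparable vertices can be given the same coordinate. -/
lemma exists_equal_coord {L B : V → V → Prop} {f : V → ℝ} (hL : ∀ p q, L p q → f p < f q)
    (hB : ∀ p q, B p q → f p = f q) {u v : V} (huv : strip B u ≠ strip B v)
    (h1 : ¬ Prec L B u v) (h2 : ¬ Prec L B v u) :
    ∃ F : V → ℝ, (∀ p q, L p q → F p < F q) ∧ (∀ p q, B p q → F p = F q) ∧ F u = F v := by
  have key : ∀ u v, strip B u ≠ strip B v → ¬ Prec L B u v → f u ≤ f v →
      ∃ F : V → ℝ, (∀ p q, L p q → F p < F q) ∧ (∀ p q, B p q → F p = F q) ∧ F u = F v := by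
    intro u v huv h1 hle
    -- Everything reachable from $u$ moves up by the difference of the two values, while $v$, not
    -- reachable from $u$, stays.
    obtain ⟨F, F1, F2, F3, F4⟩ := exists_raise hL hB
      (fun w => strip B u = strip B w ∨ Prec L B u w)
      (by
        rintro p q hpq (hp | hp)
        · exact Or.inr ((Prec.of_rel hpq).congr hp.symm rfl)
        · exact Or.inr (hp.trans (Prec.of_rel hpq)))
      (by
        intro p q hpq
        have e := strip_eq_of_rel hpq
        exact ⟨fun hp => hp.imp (fun h => h.trans e) fun h => h.congr rfl e,
          fun hp => hp.imp (fun h => h.trans e.symm) fun h => h.congr rfl e.symm⟩)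
      (sub_nonneg.2 hle)
    refine ⟨F, F1, F2, ?_⟩
    rw [F3 u (Or.inl rfl), F4 v (not_or.2 ⟨huv, h1⟩)]
    ring
  rcases le_total (f u) (f v) with hle | hle
  · exact key u v huv h1 hle
  · obtain ⟨F, F1, F2, F3⟩ := key v u huv.symm h2 hle
    exact ⟨F, F1, F2, F3.symm⟩

/-- If two vertices on different vertical paths are incomparable, some drawing has a vertex from
which no edge leads closer to another vertex. -/
theorem exists_stuck (h : ConvexGrid G x y P) [Finite V] {u v : V}
    (huv : strip (Rightward G y x) u ≠ strip (Rightward G y x) v)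
    (h1 : ¬ Prec (Rightward G x y) (Rightward G y x) u v)
    (h2 : ¬ Prec (Rightward G x y) (Rightward G y x) v u) :
    ∃ X Y, Respects (Rightward G x y) (Rightward G y x) X Y ∧ ∃ s v, s ≠ v ∧
      ∀ w, G.Adj s w → (X s - X v) ^ 2 + (Y s - Y v) ^ 2 ≤ (X w - X v) ^ 2 + (Y w - Y v) ^ 2 := by
  have key : ∀ u v, strip (Rightward G y x) u ≠ strip (Rightward G y x) v →
      ¬ Prec (Rightward G x y) (Rightward G y x) u v →
      ¬ Prec (Rightward G x y) (Rightward G y x) v u →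
      Prec (Rightward G y x) (Rightward G x y) u v →
      ∃ X Y, Respects (Rightward G x y) (Rightward G y x) X Y ∧ ∃ s v, s ≠ v ∧
      ∀ w, G.Adj s w →
        (X s - X v) ^ 2 + (Y s - Y v) ^ 2 ≤ (X w - X v) ^ 2 + (Y w - Y v) ^ 2 := by
    intro u v huv h1 h2 hp
    -- The dead end is the highest vertex on the vertical path of $u$ that still precedes $v$ in
    -- $D_y$.
    obtain ⟨s, ⟨hs, hsv⟩, hmax⟩ := Set.exists_max_image
      {w | strip (Rightward G y x) u = strip (Rightward G y x) w ∧
        Prec (Rightward G y x) (Rightward G x y) w v} y (Set.toFinite _) ⟨u, rfl, hp⟩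
    have hlt : y s < y v := prec_lt hsv
    obtain ⟨X, X1, X2, X3⟩ := exists_equal_coord (f := x) (L := Rightward G x y)
      (B := Rightward G y x) respects_self.x_lt respects_self.x_eq huv h1 h2
    -- All that $v$ precedes in $D_y$ rises by the height difference of $s$ and $v$, while $s$ and
    -- $v$ stay.
    obtain ⟨Y, Y1, Y2, Y3, Y4⟩ := exists_raise (f := y) (L := Rightward G y x)
      (B := Rightward G x y) respects_self.y_lt respects_self.y_eq
      (fun w => Prec (Rightward G y x) (Rightward G x y) v w)
      (fun p q hpq hvp => hvp.trans (Prec.of_rel hpq))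
      (fun p q hpq => ⟨fun hh => hh.congr rfl (strip_eq_of_rel hpq),
        fun hh => hh.congr rfl (strip_eq_of_rel hpq).symm⟩) (sub_nonneg.2 hlt.le)
    refine ⟨X, Y, ⟨X1, X2, Y1, Y2⟩, s, v, fun e => huv (e ▸ hs), fun w hw => ?_⟩
    have hXs : X s = X v := (eq_of_strip_eq X2 hs).symm.trans X3
    have hYs : Y s = y s := Y4 s fun hh => absurd (prec_lt hh) hlt.le.not_gt
    have hYv : Y v = y v := Y4 v fun hh => absurd (prec_lt hh) (lt_irrefl _)
    rcases h.adj_cases hw with g | g | g | g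
    · rw [← Y2 _ _ g, hXs]
      nlinarith [sq_nonneg (X w - X v)]
    · rw [Y2 _ _ g, hXs]
      nlinarith [sq_nonneg (X w - X v)]
    · have hcol := hs.trans (strip_eq_of_rel g)
      -- The upper neighbour of $s$ is incomparable to $v$ in $D_x$, hence comparable in $D_y$. By
      -- maximality of $s$ it lies above $v$, so it was raised and ends up further from $v$ than $s$
      -- is.
      have hvw : Prec (Rightward G y x) (Rightward G x y) v w := by
        rcases h.comparable_of_ne (u := w) (v := v) (fun e => huv (e ▸ hcol)) with
          (hh | hh) | (hh | hh)
        · exact absurd (hh.congr hcol.symm rfl) h1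
        · exact absurd (hh.congr rfl hcol.symm) h2
        · exact absurd g.2.2 (hmax w ⟨hcol, hh⟩).not_gt
        · exact hh
      have hYw := Y3 w hvw
      have hyw : y v < y w := prec_lt hvw
      rw [← X2 _ _ g, hYs, hYv, hYw]
      nlinarith
    · have hYw := Y1 _ _ g
      rw [X2 _ _ g]
      nlinarith
  rcases h.comparable_of_ne (u := u) (v := v) (fun e => huv (by rw [e])) with
    (hh | hh) | (hh | hh)
  · exact absurd hh h1
  · exact absurd hh h2
  · exact key u v huv h1 h2 hh
  · exact key v u huv.symm h2 h1 hh

end ConvexGrid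

/-! ### Progress towards the target in the absence of conflicts. -/

namespace ConvexGrid

variable {V : Type*} {G : SimpleGraph V} {x y : V → ℝ} {P : ℝ → ℝ → Prop}

/-- If the edge leaving `u` to the right ends beyond `v`, and `v` is above it and preceded by `u`,
then some edge leaves `u` upwards. -/
lemma exists_up_of_overshoot (h : ConvexGrid G x y P) {u v w : V}
    (hw : Rightward G x y u w) (hvw : x v < x w) (hy : y u < y v)
    (hp : Prec (Rightward G x y) (Rightward G y x) u v) : ∃ w', Rightward G y x u w' := by
  by_contra! hup
  -- The edge $uw$ is a barrier: a vertical edge coming from below could pass it only at $u$, which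
  -- has no upward edge, or at $w$, which is beyond $v$.
  have vert : ∀ a b, (a = u ∨ y a < y u) → x u ≤ x a → x a ≤ x v →
      (Rightward G y x a b ∨ Rightward G y x b a) → (b = u ∨ y b < y u) := by
    intro a b ha h1 h2 hab
    by_contra! hb
    rcases hab with hab | hab
    · rcases ha with rfl | ha
      · exact hup b hab
      · obtain ⟨c, rfl | rfl, c2, c3, c4⟩ := h.crossing hw hab h1 (h2.trans hvw.le) ha.le hb.2
        · rcases c2 with rfl | rfl
          · exact lt_irrefl _ ha
          · exact hb.1 rfl
        · linarith
    · have := hab.2.2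
      rcases ha with rfl | ha <;> linarith [hb.2]
  -- A directed path of $D_x$ from $u$ thus stays at $u$ or below it until it has passed the column
  -- of $v$, so it cannot reach $v$ above.
  have key : ∀ c, Relation.ReflTransGen
      (fun c d => ∃ p q, Rightward G x y p q ∧ strip (Rightward G y x) p = c ∧
        strip (Rightward G y x) q = d) (strip (Rightward G y x) u) c →
      ∀ t, strip (Rightward G y x) t = c → x t ≤ x v → x u ≤ x t ∧ (t = u ∨ y t < y u) := by
    have column : ∀ a b, (a = u ∨ y a < y u) → x u ≤ x a → x a ≤ x v →
        strip (Rightward G y x) a = strip (Rightward G y x) b → (b = u ∨ y b < y u) := by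
      intro a b ha h1 h2 hab
      refine (strip_induction (S := fun b => x b = x a ∧ (b = u ∨ y b < y u)) ⟨rfl, ha⟩ ?_ hab).2
      rintro c d ⟨e1, e2⟩ hcd
      refine ⟨?_, vert c d e2 (e1 ▸ h1) (e1 ▸ h2) hcd⟩
      rcases hcd with hcd | hcd
      · exact hcd.2.1.symm.trans e1
      · exact hcd.2.1.trans e1
    intro c hc
    induction hc with
    | refl =>
      intro t ht htv
      have e := x_eq_of_strip_eq ht
      exact ⟨e.ge, column u t (Or.inl rfl) le_rfl (e ▸ htv) ht.symm⟩
    | tail _ hcd ih =>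
      obtain ⟨p, q, hpq, e1, e2⟩ := hcd
      intro t ht htv
      have e := x_eq_of_strip_eq (e2.trans ht.symm)
      have hlt := hpq.2.2
      obtain ⟨i1, i2⟩ := ih p e1 (by linarith)
      have hq : q = u ∨ y q < y u := by
        rcases i2 with rfl | i2
        · rw [← h.rightward_unique hw hpq] at e
          linarith
        · exact Or.inr (hpq.2.1 ▸ i2)
      exact ⟨by linarith, column q t hq (by linarith) (by linarith) (e2.trans ht.symm)⟩
  rcases (key _ (Relation.TransGen.to_reflTransGen hp) v rfl le_rfl).2 with rfl | h1
  · exact lt_irrefl _ hy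
  · linarith

/-- The rectangle spanned by two edges leaving a vertex to the right and upwards contains no
vertex in its interior. -/
lemma not_overshoot_both (h : ConvexGrid G x y P) [Finite V] {u v w w' : V}
    (hw : Rightward G x y u w) (hw' : Rightward G y x u w') (h1 : x u < x v) (h2 : x v < x w)
    (h3 : y u < y v) (h4 : y v < y w') : False := by
  have hu : Attached G x y u (x u) (y v) := attached_of_rel hw' h3.le h4.le
  obtain ⟨ε, hε, hloc⟩ := exists_local G x y (x u) (y v)
  -- A horizontal edge starting here would have its left end in the interior of the edge $uw'$.
  have hfree : ∀ r, x u < r → r < x u + ε → ¬ OnEdges G x y r (y v) := by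
    intro r e1 e2 hC
    obtain ⟨a, b, hab, f1, f2, f3, -⟩ := hloc r (y v) (by rw [abs_lt]; constructor <;> linarith)
      (by simpa using hε) hC
    obtain ⟨a, b, hab, f1, f2, f3⟩ := h.exists_rightward_of_mem hab e1 f1 f3 f2
    have hxa := hu.x_eq_of_rightward h hab f1 f2 (e1.trans_le f3)
    rcases h.swap.vertex_on_rightward (w := a) hw' (by linarith) (by linarith) hxa with rfl | rfl
    · linarith
    · linarith
  obtain ⟨z, hz1, hz2⟩ := exists_between (lt_min h1 (lt_add_of_pos_right (x u) hε))
  have hzv := hz2.trans_le (min_le_left _ _)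
  have hze := hz2.trans_le (min_le_right _ _)
  have hPz : P z (y v) := h.hconvex (x u) (x v) z (y v) (h.region _ _ (hu.onEdges h))
    (h.region _ _ (h.onEdges_vertex v)) hz1.le hzv.le
  obtain ⟨a, b, c, d, hz, ht, hR, p, q, p1, p2, q1, q2, -, hl, -⟩ :=
    h.exists_cell hPz (hfree z hz1 hze)
  -- The face to the right of $uw'$ at the height of $v$ has its lower left corner at $u$ and is no
  -- wider than the way to $v$, so its lower right corner would be a vertex inside the edge $uw$.
  have ha : a = x u := by
    apply le_antisymm
    · by_contra! hlt
      obtain ⟨ul, hul, -⟩ := hl (y v) ⟨ht.1.le, ht.2.le⟩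
      exact hfree a hlt (hz.1.trans hze) (hul.onEdges h)
    · by_contra! hlt
      exact hR (x u) ⟨hlt, hz1.trans hz.2⟩ (y v) ht (hu.onEdges h)
  have hb : b ≤ x v := by
    by_contra! hlt
    exact hR (x v) ⟨ha ▸ h1, hlt⟩ (y v) ht (h.onEdges_vertex v)
  have hc : y u ≤ c := by
    by_contra! hlt
    exact hR z hz (y u) ⟨hlt, h3.trans ht.2⟩
      ⟨u, w, hw.1, mem_uIcc.2 (Or.inl ⟨hz1.le, (hzv.trans h2).le⟩), left_mem_uIcc⟩
  have hpu : p = u := by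
    rcases h.swap.vertex_on_rightward (w := p) hw' (p2 ▸ hc) (by linarith [ht.1]) (p1.trans ha)
      with e | e
    · exact e
    · rw [← e] at h4
      linarith [ht.1]
  have hcu : c = y u := by rw [← p2, hpu]
  have := hz.2
  rcases h.vertex_on_rightward (w := q) hw (by linarith) (by linarith) (q2.trans hcu) with rfl | rfl
  · linarith
  · linarith

/-- Vertices on different vertical and different horizontal paths are comparable in both orders. -/
def Unconflicted (L B : V → V → Prop) : Prop :=
  ∀ u v, strip B u ≠ strip B v → strip L u ≠ strip L v →
    (Prec L B u v ∨ Prec L B v u) ∧ (Prec B L u v ∨ Prec B L v u)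

lemma Unconflicted.swap {L B : V → V → Prop} (h : Unconflicted L B) : Unconflicted B L :=
  fun u v h1 h2 => (h u v h2 h1).symm

lemma Unconflicted.flip_left {L B : V → V → Prop} (h : Unconflicted L B) :
    Unconflicted (flip L) B := by
  intro u v h1 h2
  rw [prec_flip_left, prec_flip_left, prec_flip_right, prec_flip_right]
  exact (h u v h1 (fun e => h2 (strip_flip.2 e))).imp_left Or.symm

/-- In the absence of conflicts, from `u` an edge leads towards `v` without passing it. -/
theorem exists_progress (h : ConvexGrid G x y P) [Finite V]
    (hcf : Unconflicted (Rightward G x y) (Rightward G y x)) {u v : V}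
    (h1 : Prec (Rightward G x y) (Rightward G y x) u v)
    (h2 : Prec (Rightward G y x) (Rightward G x y) u v) :
    ∃ w, (Rightward G x y u w ∧ (Prec (Rightward G x y) (Rightward G y x) w v ∨
        strip (Rightward G y x) w = strip (Rightward G y x) v)) ∨
      (Rightward G y x u w ∧ (Prec (Rightward G y x) (Rightward G x y) w v ∨
        strip (Rightward G x y) w = strip (Rightward G x y) v)) := by
  have hx : x u < x v := prec_lt h1
  have hy : y u < y v := prec_lt h2
  by_contra! hcon
  -- Since $w$ and $v$ are on different rows, without conflicts a vertex $w$ that neither precedes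
  -- $v$ nor shares its column is preceded by $v$.
  have hright : ∀ w, Rightward G x y u w → x v < x w := by
    intro w hw
    obtain ⟨c1, c2⟩ := (hcon w).1 hw
    have hrow : strip (Rightward G x y) w ≠ strip (Rightward G x y) v := fun e =>
      hy.ne (eq_of_strip_eq (f := y) (fun _ _ h => h.2.1) ((strip_eq_of_rel hw).trans e))
    exact prec_lt ((hcf w v c2 hrow).1.resolve_left c1)
  have hup : ∀ w, Rightward G y x u w → y v < y w := by
    intro w hw
    obtain ⟨c1, c2⟩ := (hcon w).2 hw
    have hcol : strip (Rightward G y x) w ≠ strip (Rightward G y x) v := fun e =>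
      hx.ne (eq_of_strip_eq (f := x) (fun _ _ h => h.2.1) ((strip_eq_of_rel hw).trans e))
    exact prec_lt ((hcf w v hcol c2).2.resolve_left c1)
  have hboth : ∀ w w', Rightward G x y u w → Rightward G y x u w' → False := fun w w' hw hw' =>
    h.not_overshoot_both hw hw' hx (hright w hw) hy (hup w' hw')
  by_cases hr : ∃ w, Rightward G x y u w
  · obtain ⟨w, hw⟩ := hr
    obtain ⟨w', hw'⟩ := h.exists_up_of_overshoot hw (hright w hw) hy h1
    exact hboth w w' hw hw'
  · by_cases hu : ∃ w, Rightward G y x u w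
    · obtain ⟨w', hw'⟩ := hu
      obtain ⟨w, hw⟩ := h.swap.exists_up_of_overshoot hw' (hup w' hw') hx h2
      exact hboth w w' hw hw'
    · push Not at hr hu
      have := h.quadrant_empty hr hu hx.le hy.le
      rw [this] at hx
      exact lt_irrefl _ hx

/-- One of the two coordinates of `w` is that of `u`, and the other one is closer to `v`. -/
def Closer (X Y : V → ℝ) (u w v : V) : Prop :=
  (Y w = Y u ∧ |X w - X v| < |X u - X v|) ∨ (X w = X u ∧ |Y w - Y v| < |Y u - Y v|)

lemma Closer.swap {X Y : V → ℝ} {u w v : V} (h : Closer X Y u w v) : Closer Y X u w v :=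
  Or.symm h

lemma closer_neg {X Y : V → ℝ} {u w v : V} :
    Closer (fun a => -X a) Y u w v ↔ Closer X Y u w v := by
  simp only [Closer, neg_inj, neg_sub_neg, abs_sub_comm (X v)]

lemma abs_sub_lt_of_lt_of_le {a b c : ℝ} (h1 : a < b) (h2 : b ≤ c) : |b - c| < |a - c| := by
  rw [abs_of_nonpos (by linarith), abs_of_neg (by linarith)]
  linarith

variable {X Y : V → ℝ}

/-- Progress is expressed in the orders alone, so it transfers from the convex drawing to any
coordinates `X`, `Y` with the same edge directions. -/
lemma exists_closer_of_prec (h : ConvexGrid G x y P) [Finite V]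
    (hcf : Unconflicted (Rightward G x y) (Rightward G y x))
    (hL : Rightward G X Y = Rightward G x y) (hB : Rightward G Y X = Rightward G y x) {u v : V}
    (h1 : Prec (Rightward G x y) (Rightward G y x) u v)
    (h2 : Prec (Rightward G y x) (Rightward G x y) u v) : ∃ w, G.Adj u w ∧ Closer X Y u w v := by
  obtain ⟨w, ⟨hw, hp⟩ | ⟨hw, hp⟩⟩ := h.exists_progress hcf h1 h2
  · rw [← hL, ← hB] at hp
    rw [← hL] at hw
    refine ⟨w, hw.1, Or.inl ⟨hw.2.1.symm, abs_sub_lt_of_lt_of_le hw.2.2 ?_⟩⟩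
    rcases hp with hp | hp
    · exact (prec_lt hp).le
    · exact (x_eq_of_strip_eq hp).le
  · rw [← hL, ← hB] at hp
    rw [← hB] at hw
    refine ⟨w, hw.1, Or.inr ⟨hw.2.1.symm, abs_sub_lt_of_lt_of_le hw.2.2 ?_⟩⟩
    rcases hp with hp | hp
    · exact (prec_lt hp).le
    · exact (x_eq_of_strip_eq hp).le

lemma exists_closer_of_strip_eq (h : ConvexGrid G x y P)
    (hL : Rightward G X Y = Rightward G x y) {u v : V} (huv : u ≠ v)
    (he : strip (Rightward G x y) u = strip (Rightward G x y) v) :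
    ∃ w, G.Adj u w ∧ Closer X Y u w v := by
  have hc := h.strip_chain he
  rw [← hL] at hc
  rcases hc with hc | hc
  · rcases Relation.ReflTransGen.cases_head hc with rfl | ⟨w, huw, hwv⟩
    · exact absurd rfl huv
    · exact ⟨w, huw.1, Or.inl ⟨huw.2.1.symm,
        abs_sub_lt_of_lt_of_le huw.2.2 (le_of_chain hwv).1⟩⟩
  · rcases Relation.ReflTransGen.cases_tail hc with rfl | ⟨w, hvw, hwu⟩
    · exact absurd rfl huv
    · refine ⟨w, hwu.1.symm, Or.inl ⟨hwu.2.1, ?_⟩⟩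
      have e1 := (le_of_chain hvw).1
      have e2 := hwu.2.2
      rw [abs_of_nonneg (by linarith), abs_of_nonneg (by linarith)]
      linarith

lemma exists_closer_of_prec_right (h : ConvexGrid G x y P) [Finite V]
    (hcf : Unconflicted (Rightward G x y) (Rightward G y x))
    (hL : Rightward G X Y = Rightward G x y) (hB : Rightward G Y X = Rightward G y x) {u v : V}
    (h1 : Prec (Rightward G x y) (Rightward G y x) u v ∨
      Prec (Rightward G x y) (Rightward G y x) v u)
    (h2 : Prec (Rightward G y x) (Rightward G x y) u v) : ∃ w, G.Adj u w ∧ Closer X Y u w v := by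
  rcases h1 with h1 | h1
  · exact h.exists_closer_of_prec hcf hL hB h1 h2
  · have := h.neg.exists_closer_of_prec (X := fun a => -X a) (Y := Y) (u := u) (v := v)
    simp only [rightward_neg_left, rightward_neg_right, prec_flip_left, prec_flip_right,
      closer_neg, hL, hB] at this
    exact this hcf.flip_left trivial trivial h1 h2

/-- In the absence of conflicts, in every drawing an edge leads closer to a given vertex. -/
theorem exists_closer (h : ConvexGrid G x y P) [Finite V]
    (hcf : Unconflicted (Rightward G x y) (Rightward G y x))
    (hL : Rightward G X Y = Rightward G x y) (hB : Rightward G Y X = Rightward G y x) {u v : V}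
    (huv : u ≠ v) : ∃ w, G.Adj u w ∧ Closer X Y u w v := by
  by_cases hrow : strip (Rightward G x y) u = strip (Rightward G x y) v
  · exact h.exists_closer_of_strip_eq hL huv hrow
  by_cases hcol : strip (Rightward G y x) u = strip (Rightward G y x) v
  · obtain ⟨w, hw, hc⟩ := h.swap.exists_closer_of_strip_eq hB huv hcol
    exact ⟨w, hw, hc.swap⟩
  obtain ⟨h1, h2⟩ := hcf u v hcol hrow
  rcases h2 with h2 | h2
  · exact h.exists_closer_of_prec_right hcf hL hB h1 h2
  · have := h.swap.neg.swap.exists_closer_of_prec_right (X := X) (Y := fun a => -Y a) (u := u)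
      (v := v)
    simp only [rightward_neg_left, rightward_neg_right, prec_flip_left, prec_flip_right,
      hL, hB] at this
    obtain ⟨w, hw, hc⟩ := this hcf.swap.flip_left.swap trivial trivial h1 h2
    exact ⟨w, hw, (closer_neg.1 hc.swap).swap⟩

end ConvexGrid

/-! ### From the plane to coordinates. -/

lemma mem_segment_iff_of_rectilinear {a b p : Plane} (hab : a 0 = b 0 ∨ a 1 = b 1) :
    p ∈ segment ℝ a b ↔ p 0 ∈ uIcc (a 0) (b 0) ∧ p 1 ∈ uIcc (a 1) (b 1) := by
  have hcoord : ∀ i : Fin 2, p ∈ segment ℝ a b → p i ∈ uIcc (a i) (b i) := by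
    rintro i ⟨c, d, hc, hd, hcd, rfl⟩
    rw [← segment_eq_uIcc]
    exact ⟨c, d, hc, hd, hcd, by simp⟩
  refine ⟨fun h => ⟨hcoord 0 h, hcoord 1 h⟩, fun ⟨h0, h1⟩ => ?_⟩
  rw [← segment_eq_uIcc] at h0 h1
  have hext : ∀ c d : ℝ, 0 ≤ c → 0 ≤ d → c + d = 1 → c * a 0 + d * b 0 = p 0 →
      c * a 1 + d * b 1 = p 1 → p ∈ segment ℝ a b := by
    intro c d hc hd hcd e0 e1
    refine ⟨c, d, hc, hd, hcd, ?_⟩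
    ext i
    fin_cases i
    · simpa using e0
    · simpa using e1
  rcases hab with hab | hab
  · obtain ⟨c, d, hc, hd, hcd, e⟩ := h1
    rw [hab, segment_same, mem_singleton_iff] at h0
    refine hext c d hc hd hcd ?_ e
    rw [hab, ← add_mul, hcd, one_mul, h0]
  · obtain ⟨c, d, hc, hd, hcd, e⟩ := h0
    rw [hab, segment_same, mem_singleton_iff] at h1
    refine hext c d hc hd hcd e ?_
    rw [hab, ← add_mul, hcd, one_mul, h1]

lemma dist_lt_dist_iff {a b c d : Plane} : dist a b < dist c d ↔
    (a 0 - b 0) ^ 2 + (a 1 - b 1) ^ 2 < (c 0 - d 0) ^ 2 + (c 1 - d 1) ^ 2 := by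
  rw [EuclideanSpace.dist_eq, EuclideanSpace.dist_eq,
    Real.sqrt_lt_sqrt_iff (Finset.sum_nonneg fun _ _ => sq_nonneg _)]
  simp [Fin.sum_univ_two, Real.dist_eq, sq_abs]

/-- Moving a point of the closed rectangle slightly towards the centre puts it in the interior. -/
lemma mem_closure_rectangle {a b c d : ℝ} (hab : a < b) (hcd : c < d) {q : Plane}
    (h0 : q 0 ∈ Icc a b) (h1 : q 1 ∈ Icc c d) :
    q ∈ closure {p : Plane | p 0 ∈ Ioo a b ∧ p 1 ∈ Ioo c d} := by
  have hline : ∀ {a b r l : ℝ}, a < b → r ∈ Icc a b → l ∈ Ioo (0 : ℝ) 1 →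
      r + l * ((a + b) / 2 - r) ∈ Ioo a b := by
    intro a b r l hab hr hl
    constructor <;> nlinarith [hr.1, hr.2, hl.1, hl.2, mul_pos hl.1 (sub_pos.2 hab),
      mul_nonneg (sub_nonneg.2 hl.2.le) (sub_nonneg.2 hr.1),
      mul_nonneg (sub_nonneg.2 hl.2.le) (sub_nonneg.2 hr.2)]
  have ht : Filter.Tendsto (fun l : ℝ => q + l • (!₂[(a + b) / 2, (c + d) / 2] - q))
      (nhdsWithin 0 (Ioi 0)) (nhds q) := by
    have hc : Continuous fun l : ℝ => q + l • (!₂[(a + b) / 2, (c + d) / 2] - q) := by fun_prop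
    have := hc.tendsto 0
    simp only [zero_smul, add_zero] at this
    exact this.mono_left nhdsWithin_le_nhds
  refine mem_closure_of_tendsto ht ?_
  filter_upwards [Ioo_mem_nhdsGT (zero_lt_one' ℝ)] with l hl
  constructor
  · simpa using hline hab h0 hl
  · simpa using hline hcd h1 hl

section Graphs

variable {V : Type*} {G : SimpleGraph V}

lemma IsBiconnected.preconnected (hG : IsBiconnected G) : G.Preconnected := by
  intro u v
  by_cases huv : u = v
  · rw [huv]
  · obtain ⟨p, -⟩ := hG u v huv
    exact ⟨p⟩

namespace RectilinearDrawing

variable (Γ : RectilinearDrawing G)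

lemma mem_segment_iff {u v : V} (huv : G.Adj u v) {p : Plane} :
    p ∈ segment ℝ (Γ.pos u) (Γ.pos v) ↔
      p 0 ∈ uIcc (Γ.pos u 0) (Γ.pos v 0) ∧ p 1 ∈ uIcc (Γ.pos u 1) (Γ.pos v 1) :=
  mem_segment_iff_of_rectilinear (Γ.rectilinear u v huv)

lemma mem_carrier_iff (hadj : ∀ u, ∃ v, G.Adj u v) {s t : ℝ} :
    !₂[s, t] ∈ Γ.carrier ↔ OnEdges G (fun u => Γ.pos u 0) (fun u => Γ.pos u 1) s t := by
  simp only [carrier, mem_union, mem_range, mem_iUnion, OnEdges]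
  constructor
  · rintro (⟨u, hu⟩ | ⟨u, v, huv, hp⟩)
    · obtain ⟨v, hv⟩ := hadj u
      have e0 : Γ.pos u 0 = s := by simp [hu]
      have e1 : Γ.pos u 1 = t := by simp [hu]
      exact ⟨u, v, hv, e0 ▸ left_mem_uIcc, e1 ▸ left_mem_uIcc⟩
    · exact ⟨u, v, huv, by simpa using (Γ.mem_segment_iff huv).1 hp⟩
  · rintro ⟨u, v, huv, hp⟩
    exact Or.inr ⟨u, v, huv, (Γ.mem_segment_iff huv).2 (by simpa using hp)⟩

lemma mem_compl_externalFace_of_mem_carrier {p : Plane} (hp : p ∈ Γ.carrier) :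
    p ∈ Γ.externalFaceᶜ := fun h => h.1 hp

/-- Adding a point of its closure keeps a connected set connected, so such a point outside the
drawing would belong to the face. This makes the sides of a rectangular face part of the drawing. -/
lemma mem_carrier_of_mem_closure {p q : Plane}
    (hq : q ∈ closure (connectedComponentIn Γ.carrierᶜ p))
    (hq' : q ∉ connectedComponentIn Γ.carrierᶜ p) : q ∈ Γ.carrier := by
  by_contra hqc
  have hpc : p ∈ Γ.carrierᶜ := by
    by_contra hpc
    rw [connectedComponentIn_eq_empty hpc, closure_empty] at hq
    exact hq
  have hpre : IsPreconnected (insert q (connectedComponentIn Γ.carrierᶜ p)) :=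
    isPreconnected_connectedComponentIn.subset_closure (subset_insert _ _)
      (insert_subset hq subset_closure)
  exact hq' (hpre.subset_connectedComponentIn (mem_insert_of_mem _ (mem_connectedComponentIn hpc))
    (insert_subset hqc (connectedComponentIn_subset _ _)) (mem_insert _ _))

lemma exists_rectangle (hΓ : ∀ F, Γ.IsInternalFace F → IsOpenRectangle F) {p : Plane}
    (hp : p ∈ Γ.externalFaceᶜ) (hpc : p ∉ Γ.carrier) :
    ∃ a b c d, p 0 ∈ Ioo a b ∧ p 1 ∈ Ioo c d ∧
      (∀ q : Plane, q 0 ∈ Ioo a b → q 1 ∈ Ioo c d → q ∉ Γ.carrier) ∧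
      ∀ q : Plane, q 0 ∈ Icc a b → q 1 ∈ Icc c d → ¬ (q 0 ∈ Ioo a b ∧ q 1 ∈ Ioo c d) →
        q ∈ Γ.carrier := by
  have hb : Bornology.IsBounded (connectedComponentIn Γ.carrierᶜ p) := by
    by_contra hb
    exact hp ⟨hpc, hb⟩
  obtain ⟨a, b, c, d, hab, hcd, hF⟩ := hΓ _ ⟨⟨p, hpc, rfl⟩, hb⟩
  have hmem : p ∈ connectedComponentIn Γ.carrierᶜ p := mem_connectedComponentIn hpc
  rw [hF] at hmem
  refine ⟨a, b, c, d, hmem.1, hmem.2, fun q h0 h1 => ?_, fun q h0 h1 hq => ?_⟩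
  · have : q ∈ connectedComponentIn Γ.carrierᶜ p := by
      rw [hF]
      exact ⟨h0, h1⟩
    exact connectedComponentIn_subset _ _ this
  · refine Γ.mem_carrier_of_mem_closure (p := p) ?_ ?_
    · rw [hF]
      exact mem_closure_rectangle hab hcd h0 h1
    · rw [hF]
      exact hq

lemma segment_subset_of_isOrthoconvex {S : Set Plane} (hS : IsOrthoconvex S) {p q : Plane}
    (hp : p ∈ S) (hq : q ∈ S) (i : Fin 2) (hi : p i = q i) : segment ℝ p q ⊆ S := by
  have hp' : p ∈ S ∩ {r | r i = q i} := ⟨hp, hi⟩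
  have hq' : q ∈ S ∩ {r | r i = q i} := ⟨hq, rfl⟩
  rcases hS i (q i) with h | ⟨a, b, h⟩
  · rw [h] at hp'
    exact absurd hp' (notMem_empty _)
  · rw [h] at hp' hq'
    exact ((convex_segment a b).segment_subset hp' hq').trans (h ▸ inter_subset_left)

/-- A convex drawing satisfies the conditions collected in `ConvexGrid`. -/
theorem IsConvex.convexGrid {Γ : RectilinearDrawing G} (hΓ : Γ.IsConvex) (hG : G.Preconnected)
    [Nontrivial V] : ConvexGrid G (fun u => Γ.pos u 0) (fun u => Γ.pos u 1)
      fun s t => !₂[s, t] ∈ Γ.externalFaceᶜ where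
  preconnected := hG
  exists_adj := hG.exists_adj_of_nontrivial
  inj u v h0 h1 := by
    apply Γ.injective
    ext i
    fin_cases i
    · exact h0
    · exact h1
  rect := Γ.rectilinear
  planar u v w z huv hwz hne s t h1 h2 h3 h4 := by
    obtain ⟨a, ha, ha', h⟩ := Γ.planar u v w z huv hwz hne !₂[s, t]
      ⟨(Γ.mem_segment_iff huv).2 (by simpa using ⟨h1, h2⟩),
        (Γ.mem_segment_iff hwz).2 (by simpa using ⟨h3, h4⟩)⟩
    exact ⟨a, ha, ha', by simp [← h], by simp [← h]⟩
  region s t h := Γ.mem_compl_externalFace_of_mem_carrier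
    ((Γ.mem_carrier_iff hG.exists_adj_of_nontrivial).2 h)
  hconvex s s' r t h1 h2 h3 h4 := segment_subset_of_isOrthoconvex hΓ.2 h1 h2 1 (by simp)
    ((mem_segment_iff_of_rectilinear (by simp)).2 (by simp [mem_uIcc, h3, h4]))
  vconvex s t t' r h1 h2 h3 h4 := segment_subset_of_isOrthoconvex hΓ.2 h1 h2 0 (by simp)
    ((mem_segment_iff_of_rectilinear (by simp)).2 (by simp [mem_uIcc, h3, h4]))
  face s t hP hC := by
    have hcar : ∀ {s t}, !₂[s, t] ∈ Γ.carrier ↔ _ := Γ.mem_carrier_iff hG.exists_adj_of_nontrivial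
    obtain ⟨a, b, c, d, h1, h2, h3, h4⟩ := Γ.exists_rectangle hΓ.1 hP fun h => hC (hcar.1 h)
    have hab : a ≤ b := (h1.1.trans h1.2).le
    have hcd : c ≤ d := (h2.1.trans h2.2).le
    refine ⟨a, b, c, d, by simpa using h1, by simpa using h2,
      fun p hp q hq hh => h3 !₂[p, q] (by simpa using hp) (by simpa using hq) (hcar.2 hh),
      fun q hq => ⟨?_, ?_⟩, fun p hp => ⟨?_, ?_⟩⟩
    · exact hcar.1 (h4 !₂[a, q] (by simpa using hab) (by simpa using hq) (by simp))
    · exact hcar.1 (h4 !₂[b, q] (by simpa using hab) (by simpa using hq) (by simp))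
    · exact hcar.1 (h4 !₂[p, c] (by simpa using hp) (by simpa using hcd) (by simp))
    · exact hcar.1 (h4 !₂[p, d] (by simpa using hp) (by simpa using hcd) (by simp))

/-- A drawing is greedy if from every vertex an edge leads closer to any other vertex. -/
lemma isGreedy_of_forall_exists [Finite V]
    (h : ∀ u v, u ≠ v → ∃ w, G.Adj u w ∧ dist (Γ.pos w) (Γ.pos v) < dist (Γ.pos u) (Γ.pos v)) :
    Γ.IsGreedy := by
  intro u v
  -- The bound on distances along the walk ensures that prepending $u$ does not repeat a vertex.
  suffices ∃ p : G.Walk u v, p.IsPath ∧ Γ.DistanceDecreasing p ∧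
      ∀ a ∈ p.support, dist (Γ.pos a) (Γ.pos v) ≤ dist (Γ.pos u) (Γ.pos v) by
    obtain ⟨p, h1, h2, -⟩ := this
    exact ⟨p, h1, h2⟩
  induction u using (ConvexGrid.wellFounded_coord
    fun u => -dist (Γ.pos u) (Γ.pos v)).induction with
  | _ u ih =>
  by_cases huv : u = v
  · subst huv
    exact ⟨.nil, .nil, fun i hi => absurd hi (Nat.not_lt_zero i), by simp⟩
  · obtain ⟨w, hw, hlt⟩ := h u v huv
    obtain ⟨p, hp, hdec, hsup⟩ := ih w (neg_lt_neg hlt)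
    refine ⟨.cons hw p, ?_, ?_, ?_⟩
    · rw [SimpleGraph.Walk.cons_isPath_iff]
      exact ⟨hp, fun hu => absurd hlt (hsup u hu).not_gt⟩
    · intro i hi
      cases i with
      | zero => simpa using hlt
      | succ i =>
        rw [SimpleGraph.Walk.getVert_cons_succ, SimpleGraph.Walk.getVert_cons_succ]
        exact hdec i (by simpa using hi)
    · intro a ha
      rw [SimpleGraph.Walk.support_cons, List.mem_cons] at ha
      rcases ha with rfl | ha
      · exact le_rfl
      · exact (hsup a ha).trans hlt.le

lemma IsGreedy.exists_closer {Γ : RectilinearDrawing G} (h : Γ.IsGreedy) {u v : V} (huv : u ≠ v) :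
    ∃ w, G.Adj u w ∧ dist (Γ.pos w) (Γ.pos v) < dist (Γ.pos u) (Γ.pos v) := by
  obtain ⟨p, -, hdec⟩ := h u v
  cases p with
  | nil => exact absurd rfl huv
  | cons hw p => exact ⟨_, hw, by simpa using hdec 0 (by simp)⟩

end RectilinearDrawing

/-! ### Drawings from coordinates, and the theorem. -/

namespace ConvexGrid

variable {x y X Y : V → ℝ} {P : ℝ → ℝ → Prop}

/-- The drawing with prescribed coordinates. -/
noncomputable def drawing (h : ConvexGrid G x y P) [Finite V]
    (hr : Respects (Rightward G x y) (Rightward G y x) X Y) : RectilinearDrawing G :=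
  have hrect : ∀ u v, G.Adj u v → X u = X v ∨ Y u = Y v := by
    intro u v huv
    rcases h.adj_cases huv with g | g | g | g
    · exact Or.inr (hr.y_eq _ _ g)
    · exact Or.inr (hr.y_eq _ _ g).symm
    · exact Or.inl (hr.x_eq _ _ g)
    · exact Or.inl (hr.x_eq _ _ g).symm
  { pos := fun u => !₂[X u, Y u]
    injective := fun u v huv => h.injective_of_respects hr
      (by simpa using congrArg (fun p : Plane => p 0) huv)
      (by simpa using congrArg (fun p : Plane => p 1) huv)
    rectilinear := fun u v huv => by simpa using hrect u v huv
    planar := fun u v w z huv hwz hne p hp => by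
      have h1 := (mem_segment_iff_of_rectilinear (by simpa using hrect u v huv)).1 hp.1
      have h2 := (mem_segment_iff_of_rectilinear (by simpa using hrect w z hwz)).1 hp.2
      obtain ⟨a, ha, ha', e0, e1⟩ := h.planar_of_respects hr huv hwz hne
        (by simpa using h1.1) (by simpa using h1.2) (by simpa using h2.1) (by simpa using h2.2)
      refine ⟨a, ha, ha', ?_⟩
      ext i
      fin_cases i
      · simpa using e0.symm
      · simpa using e1.symm }

lemma rightward_iff_of_respects (h : ConvexGrid G x y P)
    (hr : Respects (Rightward G x y) (Rightward G y x) X Y) {u v : V} :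
    Rightward G X Y u v ↔ Rightward G x y u v := by
  refine ⟨fun hu => ?_, fun hu => ⟨hu.1, hr.y_eq _ _ hu, hr.x_lt _ _ hu⟩⟩
  rcases h.adj_cases hu.1 with g | g | g | g
  · exact g
  · exact absurd hu.2.2 (hr.x_lt _ _ g).le.not_gt
  · exact absurd hu.2.1 (hr.y_lt _ _ g).ne
  · exact absurd hu.2.1 (hr.y_lt _ _ g).ne'

end ConvexGrid

namespace RectilinearRepresentation

variable (H : RectilinearRepresentation G)

lemma isConflictFree_iff : H.IsConflictFree ↔ ConvexGrid.Unconflicted H.LeftOf H.Below := by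
  constructor
  · intro h u v hx hy
    by_contra hcon
    refine h u v ⟨hx, hy, ?_⟩
    by_contra! hcomp
    exact hcon ⟨hcomp.1.imp And.right And.right, hcomp.2.imp And.right And.right⟩
  · rintro h u v ⟨hx, hy, hcon⟩
    obtain ⟨h1, h2⟩ := h u v hx hy
    rcases hcon with hcon | hcon
    · exact hcon (h1.imp (fun h => ⟨hx, h⟩) fun h => ⟨Ne.symm hx, h⟩)
    · exact hcon (h2.imp (fun h => ⟨hy, h⟩) fun h => ⟨Ne.symm hy, h⟩)

variable {H}

lemma IsDrawing.rightward_eq {Γ : RectilinearDrawing G} (h : H.IsDrawing Γ) :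
    Rightward G (fun u => Γ.pos u 0) (fun u => Γ.pos u 1) = H.LeftOf := by
  funext u v
  exact propext (h.1 u v)

lemma IsDrawing.upward_eq {Γ : RectilinearDrawing G} (h : H.IsDrawing Γ) :
    Rightward G (fun u => Γ.pos u 1) (fun u => Γ.pos u 0) = H.Below := by
  funext u v
  exact propext (h.2 u v)

end RectilinearRepresentation

end Graphs

theorem ConvexGrid.Closer.dist_lt {V : Type*} {G : SimpleGraph V} {Γ : RectilinearDrawing G}
    {u w v : V} (h : ConvexGrid.Closer (fun u => Γ.pos u 0) (fun u => Γ.pos u 1) u w v) :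
    dist (Γ.pos w) (Γ.pos v) < dist (Γ.pos u) (Γ.pos v) := by
  rw [dist_lt_dist_iff]
  rcases h with ⟨h1, h2⟩ | ⟨h1, h2⟩
  · have := sq_lt_sq.2 h2
    simp only at h1 this
    rw [h1]
    linarith
  · have := sq_lt_sq.2 h2
    simp only at h1 this
    rw [h1]
    linarith

theorem mainTheorem2 {V : Type*} [Finite V] (G : SimpleGraph V) (hG : IsBiconnected G)
    (H : RectilinearRepresentation G) (hH : H.IsConvex) :
    H.IsUniversalGreedy ↔ H.IsConflictFree := by
  -- With at most one vertex there are no edges, and `exists_adj` of `ConvexGrid` need not hold;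
  -- both sides are then trivially true.
  rcases subsingleton_or_nontrivial V with hV | hV
  · refine ⟨fun _ u v huv => huv.1 (by rw [Subsingleton.elim u v]), fun _ Γ _ => ?_⟩
    exact Γ.isGreedy_of_forall_exists fun u v huv => absurd (Subsingleton.elim u v) huv
  obtain ⟨Γ₀, hΓ₀, hconv⟩ := hH
  have grid := hconv.convexGrid hG.preconnected
  have eL := hΓ₀.rightward_eq
  have eB := hΓ₀.upward_eq
  rw [H.isConflictFree_iff]
  constructor
  · intro hug
    -- Coordinates respecting the directions are a drawing of `H`, hence greedy, so no vertex is a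
    -- dead end.
    have noStuck : ∀ X Y, ConvexGrid.Respects H.LeftOf H.Below X Y → ∀ s v, s ≠ v →
        ∃ w, G.Adj s w ∧
          (X w - X v) ^ 2 + (Y w - Y v) ^ 2 < (X s - X v) ^ 2 + (Y s - Y v) ^ 2 := by
      intro X Y hr s v hsv
      rw [← eL, ← eB] at hr
      have hd : H.IsDrawing (grid.drawing hr) := by
        refine ⟨fun u v => ?_, fun u v => ?_⟩
        · rw [← eL]
          exact grid.rightward_iff_of_respects hr
        · rw [← eB]
          exact grid.swap.rightward_iff_of_respects hr.swap
      obtain ⟨w, hw, hlt⟩ := (hug _ hd).exists_closer hsv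
      exact ⟨w, hw, by simpa [ConvexGrid.drawing] using dist_lt_dist_iff.1 hlt⟩
    intro u v hx hy
    constructor
    · by_contra! hcon
      rw [← eL, ← eB] at hcon
      rw [← eB] at hx
      obtain ⟨X, Y, hr, s, t, hst, hstuck⟩ := grid.exists_stuck hx hcon.1 hcon.2
      rw [eL, eB] at hr
      obtain ⟨w, hw, hlt⟩ := noStuck X Y hr s t hst
      exact absurd (hstuck w hw) hlt.not_ge
    · by_contra! hcon
      rw [← eL, ← eB] at hcon
      rw [← eL] at hy
      obtain ⟨Y, X, hr, s, t, hst, hstuck⟩ := grid.swap.exists_stuck hy hcon.1 hcon.2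
      rw [eL, eB] at hr
      obtain ⟨w, hw, hlt⟩ := noStuck X Y hr.swap s t hst
      linarith [hstuck w hw]
  · intro hcf Γ hΓ
    rw [← eL, ← eB] at hcf
    refine Γ.isGreedy_of_forall_exists fun u v huv => ?_
    obtain ⟨w, hw, hc⟩ := grid.exists_closer hcf (hΓ.rightward_eq.trans eL.symm)
      (hΓ.upward_eq.trans eB.symm) huv
    exact ⟨w, hw, hc.dist_lt⟩
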